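/- All vector spaces are over $\mathbb{Q}$ and complexes are cohomologically graded. Let $\Xi$ be a set of colors, $\mathcal{O}$ a $\Xi$-colored (symmetric, unital) dg operad, $\mathcal{Z}(\mathcal{O})\subset\mathcal{O}$ its suboperad of cocycles, and $\mathcal{H}$ a dg operad with an isomorphism of dg operads $H^\bullet(\mathcal{O})\cong\mathcal{H}$, where $H^\bullet(\mathcal{O})$ has zero differential; let $\pi_{\mathcal{H}}:\mathcal{Z}(\mathcal{O})\to H^\bullet(\mathcal{O})\cong\mathcal{H}$ be the projection. Let $P$ be a $\Xi$-colored dg pseudo-cooperad with comultiplications $\Delta_{\mathbf t}$, let $P^{\diamondsuit}$ be the dg cooperad obtained from $P$ by adjoining the counit, and let $$\rho:\mathrm{Cobar}(P^{\diamondsuit})\to\mathcal{H}$$ be a quasi-isomorphism of dg operads. Here $\mathrm{Cobar}(P^{\diamondsuit})$ is the free operad on the suspension $\mathbf{s}P$ with the differential determined by $\partial(\mathbf{s}X)=-\mathbf{s}\,\partial_P X-\sum_{\mathbf t}\sum(-1)^{|X'|}\,\mathbf{s}X'\circ_{\mathbf t}\mathbf{s}X''$, where $\mathbf t$ runs over the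 isomorphism classes of leaf-labelled trees with two nodal vertices and $\Delta_{\mathbf t}X=\sum X'\otimes X''$. Assume: * (C1) there is a grading by subcollections $P=\bigoplus_{k\ge1}\mathcal{G}^kP$, with $\mathcal{G}^{\le 0}P=0$, such that $\partial_P(\mathcal{G}^kP)\subset\mathcal{G}^{k-1}P$ and $\Delta_{\mathbf t}(\mathcal{G}^mP)\subset\bigoplus_{r_1+\dots+r_q=m}\mathcal{G}^{r_1}P\otimes\dots\otimes\mathcal{G}^{r_q}P$ for every tree $\mathbf t$ with $q$ nodal vertices; * (C2) every $\mathcal{G}^kP$ is finite dimensional, and for every $\Xi$-colored corolla $\mathbf q$ the graded components of $\mathcal{O}(\mathbf q)$ are finite dimensional; * (C3) the operad $\mathcal{H}$ is generated by $\rho(\mathbf{s}\,\mathcal{G}^1P)$, and $\rho|_{\mathbf{s}\,\mathcal{G}^kP}=0$ for all $k\ge2$. For a dg operad $\mathcal{Q}$ let $\mathrm{Conv}(P,\mathcal{Q})$ be the convolution dg Lie algebra: its degree $a$ elements are the equivariant families of degree $a$ linear maps $P(\mathbf q)\to\mathcal{Q}(\mathbf q)$, its differential is $\partial f=\partial_{\mathcal{Q}}f-(-1)^{|f|}f\,\partial_P$,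 and its bracket is $[f,g]=f\bullet g-(-1)^{|f||g|}g\bullet f$, where $(f\bullet g)(X)=\sum_{\mathbf t}\mu_{\mathbf t}\big((f\otimes g)\Delta_{\mathbf t}X\big)$ with $\mathbf t$ as above and $\mu_{\mathbf t}$ the multiplication of $\mathcal{Q}$ along $\mathbf t$. Put $\mathrm{Curv}(\alpha)=\partial\alpha+\tfrac12[\alpha,\alpha]$ for $\alpha$ of degree $1$, and let $\alpha_{\mathcal{H}}\in\mathrm{Conv}(P,\mathcal{H})$, $\alpha_{\mathcal{H}}(X)=\rho(\mathbf{s}X)$, be the Maurer-Cartan element corresponding to $\rho$. Then there exists a second MC-sprout $\alpha\in\mathrm{Conv}(P,\mathcal{O})$, that is, a degree $1$ element with $\mathrm{Curv}(\alpha)(X)=0$ for all $X\in\mathcal{G}^{1}P\oplus\mathcal{G}^2P$, such that $\alpha(\mathcal{G}^1P)\subset\mathcal{Z}(\mathcal{O})$ and $\pi_{\mathcal{H}}(\alpha(X))=\alpha_{\mathcal{H}}(X)$ for all $X\in\mathcal{G}^1P$. (It is not assumed that $\mathcal{O}$ is formal.) -/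

import Mathlib

open scoped TensorProduct

universe x u v w

/-! ## Coloured corollas and labelled trees with two nodal vertices -/

/-- A `Ξ`-coloured corolla with the standard labelling of its incoming edges. -/
structure Corolla (Ξ : Type x) where
  arity : ℕ
  input : Fin arity → Ξ
  output : Ξ

namespace Corolla

variable {Ξ : Type x}

/-- A colour preserving relabelling of the incoming edges. The automorphism group of a corolla `q` is
the product of symmetric groups permuting the incoming edges of equal colour, and every corolla is
isomorphic to one whose incoming edges are sorted by colour. -/
structure Iso (q q' : Corolla Ξ) where
  perm : Fin q.arity ≃ Fin q'.arity
  input_eq : ∀ i, q'.input (perm i) = q.input i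
  output_eq : q'.output = q.output

/-- The identity relabelling. -/
def Iso.refl (q : Corolla Ξ) : Iso q q := ⟨Equiv.refl _, fun _ => rfl, rfl⟩

/-- Composition of relabellings. -/
def Iso.trans {q q' q'' : Corolla Ξ} (σ : Iso q q') (τ : Iso q' q'') : Iso q q'' :=
  ⟨σ.perm.trans τ.perm, fun i => (τ.input_eq _).trans (σ.input_eq i),
    τ.output_eq.trans σ.output_eq⟩

/-- The inverse relabelling. -/
def Iso.symm {q q' : Corolla Ξ} (σ : Iso q q') : Iso q' q :=
  ⟨σ.perm.symm, fun i => by rw [← σ.input_eq, Equiv.apply_symm_apply], σ.output_eq.symm⟩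

/-- The corolla with one incoming edge, both edges having colour `c`. -/
def unit (c : Ξ) : Corolla Ξ := ⟨1, fun _ => c, c⟩

end Corolla

/-- A `Ξ`-coloured planar tree with exactly two nodal vertices, whose leaves are labelled by the
incoming edges of the corolla `q`: the lower vertex is the corolla `r`, and the upper vertex is the
corolla `u`, whose outgoing edge is glued to the incoming edge `leg` of `r`. The map `leaf` sends the
edge `leg` to `none`, and every other incoming edge of the two vertices to its label. -/
structure Graft {Ξ : Type x} (r u q : Corolla Ξ) where
  leg : Fin r.arity
  leaf : Fin r.arity ⊕ Fin u.arity ≃ Option (Fin q.arity)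
  leaf_leg : leaf (Sum.inl leg) = none
  leg_color : r.input leg = u.output
  output_color : r.output = q.output
  lower_color : ∀ i k, leaf (Sum.inl i) = some k → r.input i = q.input k
  upper_color : ∀ j k, leaf (Sum.inr j) = some k → u.input j = q.input k

namespace Graft

variable {Ξ : Type x}

/-- Relabellings of the two vertices and of the leaves which carry the tree `g` to the tree `g'`. -/
def Compat {r u q r' u' q' : Corolla Ξ} (σ : r.Iso r') (τ : u.Iso u') (κ : q.Iso q')
    (g : Graft r u q) (g' : Graft r' u' q') : Prop :=
  ∀ s, g'.leaf (Sum.map σ.perm τ.perm s) = Option.map κ.perm (g.leaf s)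

/-- Contracting either edge of one and the same labelled tree with three nodal vertices, where `u` is
grafted on `r` and `v` is grafted on `u`: the pair `(a, b)` contracts the edge between `u` and `v`
first, and the pair `(c, d)` contracts the edge between `r` and `u` first. -/
structure Sequential {r u v w m q : Corolla Ξ} (a : Graft r w q) (b : Graft u v w)
    (c : Graft m v q) (d : Graft r u m) : Prop where
  leg_eq : d.leg = a.leg
  lower : ∀ i k, d.leaf (Sum.inl i) = some k → c.leaf (Sum.inl k) = a.leaf (Sum.inl i)
  middle : ∀ j k, d.leaf (Sum.inr j) = some k →
    c.leaf (Sum.inl k) = (b.leaf (Sum.inl j)).bind fun l => a.leaf (Sum.inr l)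
  upper : ∀ l, c.leaf (Sum.inr l) = (b.leaf (Sum.inr l)).bind fun l => a.leaf (Sum.inr l)

/-- Contracting either edge of one and the same labelled tree with three nodal vertices, where `u`
and `v` are grafted on two different edges of `r`: the pair `(a, b)` contracts the edge between `r`
and `u` first, and the pair `(c, d)` contracts the edge between `r` and `v` first. -/
structure Parallel {r u v m m' q : Corolla Ξ} (a : Graft r u m) (b : Graft m v q)
    (c : Graft r v m') (d : Graft m' u q) : Prop where
  leg_right : a.leaf (Sum.inl c.leg) = some b.leg
  leg_left : c.leaf (Sum.inl a.leg) = some d.leg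
  lower : ∀ i k k', a.leaf (Sum.inl i) = some k → c.leaf (Sum.inl i) = some k' →
    b.leaf (Sum.inl k) = d.leaf (Sum.inl k')
  left : ∀ j k, a.leaf (Sum.inr j) = some k → b.leaf (Sum.inl k) = d.leaf (Sum.inr j)
  right : ∀ l k, c.leaf (Sum.inr l) = some k → d.leaf (Sum.inl k) = b.leaf (Sum.inr l)

theorem Compat.symm {r u q r' u' q' : Corolla Ξ} {σ : r.Iso r'} {τ : u.Iso u'} {κ : q.Iso q'}
    {g : Graft r u q} {g' : Graft r' u' q'} (h : Compat σ τ κ g g') :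
    Compat σ.symm τ.symm κ.symm g' g := by
  intro s
  have h1 := h (Sum.map σ.perm.symm τ.perm.symm s)
  have h2 : Sum.map σ.perm τ.perm (Sum.map σ.perm.symm τ.perm.symm s) = s := by
    cases s <;> simp
  rw [h2] at h1
  rw [h1]
  simp [Corolla.Iso.symm, Option.map_map, Function.comp_def]

theorem Compat.trans {r u q r' u' q' r'' u'' q'' : Corolla Ξ} {σ : r.Iso r'} {τ : u.Iso u'}
    {κ : q.Iso q'} {σ' : r'.Iso r''} {τ' : u'.Iso u''} {κ' : q'.Iso q''}
    {g : Graft r u q} {g' : Graft r' u' q'} {g'' : Graft r'' u'' q''}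
    (h : Compat σ τ κ g g') (h' : Compat σ' τ' κ' g' g'') :
    Compat (σ.trans σ') (τ.trans τ') (κ.trans κ') g g'' := by
  intro s
  have h1 := h' (Sum.map σ.perm τ.perm s)
  rw [h s] at h1
  have h2 : Sum.map (σ.trans σ').perm (τ.trans τ').perm s =
      Sum.map σ'.perm τ'.perm (Sum.map σ.perm τ.perm s) := by
    cases s <;> simp [Corolla.Iso.trans]
  rw [h2, h1]
  simp [Corolla.Iso.trans, Option.map_map, Function.comp_def]

theorem Compat.congr {r u q r' u' q' : Corolla Ξ} {σ σ' : r.Iso r'} {τ τ' : u.Iso u'}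
    {κ κ' : q.Iso q'} {g : Graft r u q} {g' : Graft r' u' q'} (h : Compat σ τ κ g g')
    (hσ : σ.perm = σ'.perm) (hτ : τ.perm = τ'.perm) (hκ : κ.perm = κ'.perm) :
    Compat σ' τ' κ' g g' := by
  intro s
  rw [← hσ, ← hτ, ← hκ]
  exact h s

/-- Relabelling the leaves of a tree. -/
def relabel {r u q q' : Corolla Ξ} (κ : q.Iso q') (g : Graft r u q) : Graft r u q' where
  leg := g.leg
  leaf := g.leaf.trans (Equiv.optionCongr κ.perm)
  leaf_leg := by simp [g.leaf_leg]
  leg_color := g.leg_color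
  output_color := g.output_color.trans κ.output_eq.symm
  lower_color := by
    intro i k h
    obtain ⟨l, hl, rfl⟩ : ∃ l, g.leaf (Sum.inl i) = some l ∧ κ.perm l = k := by simpa using h
    rw [κ.input_eq, g.lower_color i l hl]
  upper_color := by
    intro i k h
    obtain ⟨l, hl, rfl⟩ : ∃ l, g.leaf (Sum.inr i) = some l ∧ κ.perm l = k := by simpa using h
    rw [κ.input_eq, g.upper_color i l hl]

theorem compat_relabel {r u q q' : Corolla Ξ} (κ : q.Iso q') (g : Graft r u q) :
    Compat (Corolla.Iso.refl r) (Corolla.Iso.refl u) κ g (g.relabel κ) := by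
  intro s
  cases s <;> simp [Corolla.Iso.refl, relabel]

end Graft

/-- The labelled trees with two nodal vertices and with leaves labelled by the incoming edges
of `q`. -/
structure TwoTree {Ξ : Type x} (q : Corolla Ξ) where
  lower : Corolla Ξ
  upper : Corolla Ξ
  graft : Graft lower upper q

namespace TwoTree

variable {Ξ : Type x}

/-- Two labelled trees are identified if they are related by a (not necessarily planar) isomorphism
which respects the labels of the leaves. -/
instance setoid (q : Corolla Ξ) : Setoid (TwoTree q) where
  r s t := ∃ (σ : s.lower.Iso t.lower) (τ : s.upper.Iso t.upper),
    Graft.Compat σ τ (Corolla.Iso.refl q) s.graft t.graft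
  iseqv :=
    { refl := fun s => ⟨Corolla.Iso.refl _, Corolla.Iso.refl _, by
        intro e; cases e <;> simp [Corolla.Iso.refl]⟩
      symm := by
        rintro s t ⟨σ, τ, h⟩
        exact ⟨σ.symm, τ.symm, h.symm⟩
      trans := by
        rintro s t z ⟨σ, τ, h⟩ ⟨σ', τ', h'⟩
        exact ⟨σ.trans σ', τ.trans τ', h.trans h'⟩ }

/-- Isomorphism classes of labelled trees with two nodal vertices. -/
abbrev Class (q : Corolla Ξ) : Type x := Quotient (TwoTree.setoid q)

/-- Relabelling the leaves. -/
def relabel {q q' : Corolla Ξ} (κ : q.Iso q') (t : TwoTree q) : TwoTree q' :=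
  ⟨t.lower, t.upper, t.graft.relabel κ⟩

/-- Relabelling the leaves of isomorphism classes. -/
def Class.relabel {q q' : Corolla Ξ} (κ : q.Iso q') : Class q → Class q' :=
  Quotient.map (TwoTree.relabel κ) (by
    rintro s t ⟨σ, τ, h⟩
    refine ⟨σ, τ, (((Graft.compat_relabel κ s.graft).symm.trans h).trans
      (Graft.compat_relabel κ t.graft)).congr ?_ ?_ ?_⟩ <;>
    ext e <;> simp [Corolla.Iso.refl, Corolla.Iso.trans, Corolla.Iso.symm])

theorem Class.relabel_relabel_symm {q q' : Corolla Ξ} (κ : q.Iso q') (z : Class q) :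
    Class.relabel κ.symm (Class.relabel κ z) = z := by
  induction z using Quotient.inductionOn with
  | _ t =>
    refine Quotient.sound ⟨Corolla.Iso.refl _, Corolla.Iso.refl _, ?_⟩
    refine (((Graft.compat_relabel κ t.graft).trans
      (Graft.compat_relabel κ.symm (t.graft.relabel κ))).symm).congr ?_ ?_ ?_
    · rfl
    · rfl
    · ext e
      simp [Corolla.Iso.refl, Corolla.Iso.trans, Corolla.Iso.symm]

/-- Relabelling the leaves is a bijection on isomorphism classes. -/
def Class.relabelEquiv {q q' : Corolla Ξ} (κ : q.Iso q') : Class q ≃ Class q' where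
  toFun := Class.relabel κ
  invFun := Class.relabel κ.symm
  left_inv := Class.relabel_relabel_symm κ
  right_inv := Class.relabel_relabel_symm κ.symm

theorem Class.exists_compat_out {q q' : Corolla Ξ} (κ : q.Iso q') (z : Class q) :
    ∃ (σ : z.out.lower.Iso (Class.relabelEquiv κ z).out.lower)
      (τ : z.out.upper.Iso (Class.relabelEquiv κ z).out.upper),
      Graft.Compat σ τ κ z.out.graft (Class.relabelEquiv κ z).out.graft := by
  have h : (TwoTree.setoid q').r (TwoTree.relabel κ z.out) (Class.relabelEquiv κ z).out := by
    apply Quotient.exact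
    rw [Quotient.out_eq]
    conv_rhs => rw [← Quotient.out_eq z]
    rfl
  obtain ⟨σ, τ, h⟩ := h
  exact ⟨(Corolla.Iso.refl _).trans σ, (Corolla.Iso.refl _).trans τ,
    (Graft.compat_relabel κ z.out.graft).trans h⟩

end TwoTree

/-! ## Collections, operads and pseudo-cooperads -/

/-- A `Ξ`-coloured collection of cochain complexes of rational vector spaces: `obj q i` is the degree
`i` component of the complex attached to the corolla `q`. -/
structure DGCollection (Ξ : Type x) where
  obj : Corolla Ξ → ℤ → Type u
  [instAddCommGroup : ∀ q i, AddCommGroup (obj q i)]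
  [instModule : ∀ q i, Module ℚ (obj q i)]
  map : ∀ {q q' : Corolla Ξ} {i : ℤ}, q.Iso q' → (obj q i →ₗ[ℚ] obj q' i)
  map_refl : ∀ {q : Corolla Ξ} {i : ℤ} (y : obj q i), map (Corolla.Iso.refl q) y = y
  map_trans : ∀ {q q' q'' : Corolla Ξ} {i : ℤ} (σ : q.Iso q') (τ : q'.Iso q'') (y : obj q i),
    map (σ.trans τ) y = map τ (map σ y)
  d : ∀ {q : Corolla Ξ} {i j : ℤ}, i + 1 = j → (obj q i →ₗ[ℚ] obj q j)
  d_d : ∀ {q : Corolla Ξ} {i j k : ℤ} (hi : i + 1 = j) (hj : j + 1 = k) (y : obj q i),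
    d hj (d hi y) = 0
  d_map : ∀ {q q' : Corolla Ξ} {i j : ℤ} (h : i + 1 = j) (σ : q.Iso q') (y : obj q i),
    d h (map σ y) = map σ (d h y)

attribute [instance] DGCollection.instAddCommGroup DGCollection.instModule

/-- A `Ξ`-coloured dg operad over the rationals. The operation `comp g` is the multiplication
attached to the labelled planar tree `g` with two nodal vertices. -/
structure DGOperad (Ξ : Type x) extends DGCollection.{x, u} Ξ where
  comp : ∀ {r u q : Corolla Ξ} {i j k : ℤ}, Graft r u q → i + j = k →
    (obj r i →ₗ[ℚ] obj u j →ₗ[ℚ] obj q k)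
  one : ∀ c : Ξ, obj (Corolla.unit c) 0
  comp_map : ∀ {r u q r' u' q' : Corolla Ξ} {i j k : ℤ} {σ : r.Iso r'} {τ : u.Iso u'}
    {κ : q.Iso q'} {g : Graft r u q} {g' : Graft r' u' q'} (h : i + j = k),
    Graft.Compat σ τ κ g g' → ∀ (y : obj r i) (z : obj u j),
    comp g' h (map σ y) (map τ z) = map κ (comp g h y z)
  comp_sequential : ∀ {r u v w m q : Corolla Ξ} {a : Graft r w q} {b : Graft u v w}
    {c : Graft m v q} {e : Graft r u m}, Graft.Sequential a b c e →
    ∀ {i j k ij jk ijk : ℤ} (hij : i + j = ij) (hjk : j + k = jk) (hl : ij + k = ijk)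
      (hr : i + jk = ijk) (y : obj r i) (z : obj u j) (t : obj v k),
    comp c hl (comp e hij y z) t = comp a hr y (comp b hjk z t)
  comp_parallel : ∀ {r u v m m' q : Corolla Ξ} {a : Graft r u m} {b : Graft m v q}
    {c : Graft r v m'} {e : Graft m' u q}, Graft.Parallel a b c e →
    ∀ {i j k ij ik ijk : ℤ} (hij : i + j = ij) (hik : i + k = ik) (hl : ij + k = ijk)
      (hr : ik + j = ijk) (y : obj r i) (z : obj u j) (t : obj v k),
    comp b hl (comp a hij y z) t = ((-1 : ℚ) ^ (j * k)) • comp e hr (comp c hik y t) z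
  comp_one : ∀ {r q : Corolla Ξ} {c : Ξ} (g : Graft r (Corolla.unit c) q) (σ : r.Iso q),
    (∀ i k, g.leaf (Sum.inl i) = some k → σ.perm i = k) →
    (∀ j, g.leaf (Sum.inr j) = some (σ.perm g.leg)) →
    ∀ {i : ℤ} (h : i + 0 = i) (y : obj r i), comp g h y (one c) = map σ y
  one_comp : ∀ {u q : Corolla Ξ} {c : Ξ} (g : Graft (Corolla.unit c) u q) (σ : u.Iso q),
    (∀ j, g.leaf (Sum.inr j) = some (σ.perm j)) →
    ∀ {i : ℤ} (h : 0 + i = i) (y : obj u i), comp g h (one c) y = map σ y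
  d_comp : ∀ {r u q : Corolla Ξ} (g : Graft r u q) {i i' j j' k k' : ℤ} (hi : i + 1 = i')
    (hj : j + 1 = j') (hk : k + 1 = k') (h : i + j = k) (hl : i' + j = k') (hr : i + j' = k')
    (y : obj r i) (z : obj u j),
    d hk (comp g h y z) =
      comp g hl (d hi y) z + ((-1 : ℚ) ^ i) • comp g hr y (d hj z)
  d_one : ∀ (c : Ξ) {j : ℤ} (h : 0 + 1 = j), d h (one c) = 0

/-- A `Ξ`-coloured dg pseudo-cooperad over the rationals. For a labelled planar tree `g` with two
nodal vertices, `cocomp g` is the component of the comultiplication `Δ_g` in bidegree `(i, j)`. The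
comultiplications of an element are jointly an element of a direct sum over the isomorphism classes of
trees and over the bidegrees, that is, finitely many of them do not vanish. -/
structure DGPseudoCooperad (Ξ : Type x) extends DGCollection.{x, v} Ξ where
  cocomp : ∀ {r u q : Corolla Ξ} {i j k : ℤ}, Graft r u q → i + j = k →
    (obj q k →ₗ[ℚ] obj r i ⊗[ℚ] obj u j)
  cocomp_map : ∀ {r u q r' u' q' : Corolla Ξ} {i j k : ℤ} {σ : r.Iso r'} {τ : u.Iso u'}
    {κ : q.Iso q'} {g : Graft r u q} {g' : Graft r' u' q'} (h : i + j = k),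
    Graft.Compat σ τ κ g g' → ∀ y : obj q k,
    cocomp g' h (map κ y) = TensorProduct.map (map σ) (map τ) (cocomp g h y)
  cocomp_sequential : ∀ {r u v w m q : Corolla Ξ} {a : Graft r w q} {b : Graft u v w}
    {c : Graft m v q} {e : Graft r u m}, Graft.Sequential a b c e →
    ∀ {i j k ij jk ijk : ℤ} (hij : i + j = ij) (hjk : j + k = jk) (hl : ij + k = ijk)
      (hr : i + jk = ijk) (y : obj q ijk),
    TensorProduct.assoc ℚ (obj r i) (obj u j) (obj v k)
        (TensorProduct.map (cocomp e hij) LinearMap.id (cocomp c hl y)) =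
      TensorProduct.map LinearMap.id (cocomp b hjk) (cocomp a hr y)
  cocomp_parallel : ∀ {r u v m m' q : Corolla Ξ} {a : Graft r u m} {b : Graft m v q}
    {c : Graft r v m'} {e : Graft m' u q}, Graft.Parallel a b c e →
    ∀ {i j k ij ik ijk : ℤ} (hij : i + j = ij) (hik : i + k = ik) (hl : ij + k = ijk)
      (hr : ik + j = ijk) (y : obj q ijk),
    TensorProduct.rightComm ℚ (obj r i) (obj u j) (obj v k)
        (TensorProduct.map (cocomp a hij) LinearMap.id (cocomp b hl y)) =
      ((-1 : ℚ) ^ (j * k)) •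
        TensorProduct.map (cocomp c hik) LinearMap.id (cocomp e hr y)
  cocomp_d : ∀ {r u q : Corolla Ξ} (g : Graft r u q) {i i' j j' k k' : ℤ} (hi : i + 1 = i')
    (hj : j + 1 = j') (hk : k + 1 = k') (h : i' + j' = k') (hl : i + j' = k) (hr : i' + j = k)
    (y : obj q k),
    cocomp g h (d hk y) =
      TensorProduct.map (d hi) LinearMap.id (cocomp g hl y) +
        ((-1 : ℚ) ^ i') • TensorProduct.map LinearMap.id (d hj) (cocomp g hr y)
  finite_cocomp : ∀ {q : Corolla Ξ} {k : ℤ} (y : obj q k),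
    {p : TwoTree.Class q × ℤ |
      cocomp p.1.out.graft (add_sub_cancel p.2 k) y ≠ 0}.Finite

/-! ## The convolution Lie algebra -/

section Convolution

variable {Ξ : Type x}

/-- The degree `a` component of the convolution Lie algebra `Conv(P, O)`: families of linear maps of
degree `a` commuting with the relabellings. -/
def Conv (P : DGPseudoCooperad.{x, v} Ξ) (O : DGOperad.{x, u} Ξ) (a : ℤ) :
    Submodule ℚ (∀ (q : Corolla Ξ) (i : ℤ), P.obj q i →ₗ[ℚ] O.obj q (i + a)) where
  carrier := {f | ∀ (q q' : Corolla Ξ) (i : ℤ) (σ : q.Iso q') (y : P.obj q i),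
    f q' i (P.map σ y) = O.map σ (f q i y)}
  add_mem' := by
    intro f g hf hg q q' i σ y
    simp [hf q q' i σ y, hg q q' i σ y]
  zero_mem' := by
    intro q q' i σ y
    simp
  smul_mem' := by
    intro c f hf q q' i σ y
    simp [hf q q' i σ y]

namespace Conv

variable {P : DGPseudoCooperad.{x, v} Ξ} {O : DGOperad.{x, u} Ξ}

/-- The linear map `P(q)^i → O(q)^j`, `j = i + a`, which belongs to an element of degree `a`. -/
def app {a : ℤ} (f : Conv P O a) {q : Corolla Ξ} {i j : ℤ} (h : i + a = j) :
    P.obj q i →ₗ[ℚ] O.obj q j := h ▸ f.1 q i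

theorem app_map {a : ℤ} (f : Conv P O a) {q q' : Corolla Ξ} {i j : ℤ} (h : i + a = j)
    (σ : q.Iso q') (y : P.obj q i) : app f h (P.map σ y) = O.map σ (app f h y) := by
  subst h
  exact f.2 q q' i σ y

/-- The contribution of the tree `t` and of the bidegree `(i, k - i)` to `f • g`, namely
`μ_t ∘ (f ⊗ g) ∘ Δ_t`, where `(f ⊗ g)(y ⊗ z) = (-1)^{|g||y|} f(y) ⊗ g(z)`. -/
def preLieTerm {a b c : ℤ} (hc : a + b = c) (f : Conv P O a) (g : Conv P O b) {q : Corolla Ξ}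
    (t : TwoTree q) (i : ℤ) {k l : ℤ} (h : k + c = l) : P.obj q k →ₗ[ℚ] O.obj q l :=
  ((-1 : ℚ) ^ (b * i)) •
    (TensorProduct.lift (O.comp t.graft (show (i + a) + ((k - i) + b) = l by omega)) ∘ₗ
      TensorProduct.map (app f rfl) (app g rfl) ∘ₗ P.cocomp t.graft (add_sub_cancel i k))

theorem preLieTerm_map {a b c : ℤ} (hc : a + b = c) (f : Conv P O a) (g : Conv P O b)
    {q q' : Corolla Ξ} {s : TwoTree q} {t : TwoTree q'} {σ : s.lower.Iso t.lower}
    {τ : s.upper.Iso t.upper} {κ : q.Iso q'} (H : Graft.Compat σ τ κ s.graft t.graft)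
    (i : ℤ) {k l : ℤ} (h : k + c = l) (y : P.obj q k) :
    preLieTerm hc f g t i h (P.map κ y) = O.map κ (preLieTerm hc f g s i h y) := by
  simp only [preLieTerm, LinearMap.smul_apply, LinearMap.comp_apply, map_smul,
    P.cocomp_map _ H]
  congr 1
  induction P.cocomp s.graft (add_sub_cancel i k) y using TensorProduct.induction_on with
  | zero => simp
  | tmul y z => simp [app_map, O.comp_map _ H]
  | add y z hy hz => simp only [map_add, hy, hz]

theorem finite_support_preLieTerm {a b c : ℤ} (hc : a + b = c) (f : Conv P O a) (g : Conv P O b)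
    {q : Corolla Ξ} {k l : ℤ} (h : k + c = l) (y : P.obj q k) :
    (Function.support fun p : TwoTree.Class q × ℤ =>
      preLieTerm hc f g p.1.out p.2 h y).Finite := by
  refine (P.finite_cocomp y).subset fun p hp => ?_
  intro h0
  apply hp
  simp [preLieTerm, h0]

/-- The pre-Lie product `f • g`: the sum of `μ_t ∘ (f ⊗ g) ∘ Δ_t` over the isomorphism classes of
labelled trees `t` with two nodal vertices. -/
noncomputable def preLie {a b c : ℤ} (hc : a + b = c) (f : Conv P O a) (g : Conv P O b) :
    Conv P O c :=
  ⟨fun q k =>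
    { toFun := fun y => ∑ᶠ p : TwoTree.Class q × ℤ, preLieTerm hc f g p.1.out p.2 rfl y
      map_add' := by
        intro y z
        simp only [map_add]
        exact finsum_add_distrib (finite_support_preLieTerm hc f g rfl y)
          (finite_support_preLieTerm hc f g rfl z)
      map_smul' := by
        intro r y
        simp only [map_smul, RingHom.id_apply]
        exact (smul_finsum' r (finite_support_preLieTerm hc f g rfl y)).symm },
   by
    intro q q' k σ y
    change (∑ᶠ p : TwoTree.Class q' × ℤ, preLieTerm hc f g p.1.out p.2 rfl (P.map σ y)) =
      O.map σ (∑ᶠ p : TwoTree.Class q × ℤ, preLieTerm hc f g p.1.out p.2 rfl y)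
    have h1 : O.map σ (∑ᶠ p : TwoTree.Class q × ℤ, preLieTerm hc f g p.1.out p.2 rfl y) =
        ∑ᶠ p : TwoTree.Class q × ℤ, O.map σ (preLieTerm hc f g p.1.out p.2 rfl y) :=
      (O.map σ).toAddMonoidHom.map_finsum (finite_support_preLieTerm hc f g rfl y)
    rw [h1, ← finsum_comp_equiv
      ((TwoTree.Class.relabelEquiv σ).prodCongr (Equiv.refl ℤ))]
    refine finsum_congr fun p => ?_
    obtain ⟨σ', τ', H⟩ := TwoTree.Class.exists_compat_out σ p.1
    exact preLieTerm_map hc f g H p.2 rfl y⟩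

/-- The Lie bracket `[f, g] = f • g - (-1)^{|f||g|} g • f`. -/
noncomputable def bracket {a b c : ℤ} (hc : a + b = c) (f : Conv P O a) (g : Conv P O b) :
    Conv P O c :=
  preLie hc f g - ((-1 : ℚ) ^ (a * b)) • preLie ((add_comm b a).trans hc) g f

/-- The differential `∂f = ∂_O ∘ f - (-1)^{|f|} f ∘ ∂_P`. -/
def differential {a b : ℤ} (hb : a + 1 = b) (f : Conv P O a) : Conv P O b :=
  ⟨fun q i =>
    O.d (show (i + a) + 1 = i + b by omega) ∘ₗ app f rfl -
      ((-1 : ℚ) ^ a) • (app f (show (i + 1) + a = i + b by omega) ∘ₗ P.d rfl),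
   by
    intro q q' i σ y
    simp [app_map, O.d_map, P.d_map]⟩

/-- `Curv(α) = ∂α + ½ [α, α]` for `α` of degree one. -/
noncomputable def curv (α : Conv P O 1) : Conv P O 2 :=
  differential (by norm_num) α + (1 / 2 : ℚ) • bracket (by norm_num) α α

end Conv

end Convolution

/-! ## Morphisms, ideals and quotients, cohomology -/

namespace DGOperad

variable {Ξ : Type x}

/-- Morphisms of dg operads. -/
structure Hom (O : DGOperad.{x, u} Ξ) (Q : DGOperad.{x, v} Ξ) where
  app : ∀ {q : Corolla Ξ} {i : ℤ}, O.obj q i →ₗ[ℚ] Q.obj q i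
  app_map : ∀ {q q' : Corolla Ξ} {i : ℤ} (σ : q.Iso q') (y : O.obj q i),
    app (O.map σ y) = Q.map σ (app y)
  app_d : ∀ {q : Corolla Ξ} {i j : ℤ} (h : i + 1 = j) (y : O.obj q i),
    app (O.d h y) = Q.d h (app y)
  app_one : ∀ c : Ξ, app (O.one c) = Q.one c
  app_comp : ∀ {r u q : Corolla Ξ} {i j k : ℤ} (g : Graft r u q) (h : i + j = k)
    (y : O.obj r i) (z : O.obj u j), app (O.comp g h y z) = Q.comp g h (app y) (app z)

/-- A morphism of dg operads is an isomorphism if all its components are bijective. -/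
def Hom.IsIso {O : DGOperad.{x, u} Ξ} {Q : DGOperad.{x, v} Ξ} (F : Hom O Q) : Prop :=
  ∀ (q : Corolla Ξ) (i : ℤ), Function.Bijective (F.app : O.obj q i → Q.obj q i)

/-- Two-sided dg ideals of a dg operad. -/
structure Ideal (O : DGOperad.{x, u} Ξ) where
  sub : ∀ (q : Corolla Ξ) (i : ℤ), Submodule ℚ (O.obj q i)
  map_mem : ∀ {q q' : Corolla Ξ} {i : ℤ} (σ : q.Iso q') {y : O.obj q i},
    y ∈ sub q i → O.map σ y ∈ sub q' i
  d_mem : ∀ {q : Corolla Ξ} {i j : ℤ} (h : i + 1 = j) {y : O.obj q i},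
    y ∈ sub q i → O.d h y ∈ sub q j
  comp_mem_left : ∀ {r u q : Corolla Ξ} {i j k : ℤ} (g : Graft r u q) (h : i + j = k)
    {y : O.obj r i} (z : O.obj u j), y ∈ sub r i → O.comp g h y z ∈ sub q k
  comp_mem_right : ∀ {r u q : Corolla Ξ} {i j k : ℤ} (g : Graft r u q) (h : i + j = k)
    (y : O.obj r i) {z : O.obj u j}, z ∈ sub u j → O.comp g h y z ∈ sub q k

/-- The quotient of a dg operad by a two-sided dg ideal. -/
def quotient (O : DGOperad.{x, u} Ξ) (I : O.Ideal) : DGOperad.{x, u} Ξ where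
  obj q i := O.obj q i ⧸ I.sub q i
  map {q q' i} σ := (I.sub q i).mapQ (I.sub q' i) (O.map σ) fun _ hy => I.map_mem σ hy
  map_refl := by
    rintro q i ⟨y⟩
    exact congrArg Submodule.Quotient.mk (O.map_refl y)
  map_trans := by
    rintro q q' q'' i σ τ ⟨y⟩
    exact congrArg Submodule.Quotient.mk (O.map_trans σ τ y)
  d {q i j} h := (I.sub q i).mapQ (I.sub q j) (O.d h) fun _ hy => I.d_mem h hy
  d_d := by
    rintro q i j k hi hj ⟨y⟩
    exact congrArg Submodule.Quotient.mk (O.d_d hi hj y)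
  d_map := by
    rintro q q' i j h σ ⟨y⟩
    exact congrArg Submodule.Quotient.mk (O.d_map h σ y)
  comp {r u q i j k} g h :=
    (I.sub r i).liftQ
      { toFun := fun y => (I.sub u j).mapQ (I.sub q k) (O.comp g h y)
          fun _ hz => I.comp_mem_right g h y hz
        map_add' := by
          intro y y'
          ext z
          simp
        map_smul' := by
          intro c y
          ext z
          simp }
      (by
        intro y hy
        ext z
        simpa using I.comp_mem_left g h z hy)
  one c := Submodule.Quotient.mk (O.one c)
  comp_map := by
    rintro r u q r' u' q' i j k σ τ κ g g' h H ⟨y⟩ ⟨z⟩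
    exact congrArg Submodule.Quotient.mk (O.comp_map h H y z)
  comp_sequential := by
    rintro r u v w m q a b c e H i j k ij jk ijk hij hjk hl hr ⟨y⟩ ⟨z⟩ ⟨t⟩
    exact congrArg Submodule.Quotient.mk (O.comp_sequential H hij hjk hl hr y z t)
  comp_parallel := by
    rintro r u v m m' q a b c e H i j k ij ik ijk hij hik hl hr ⟨y⟩ ⟨z⟩ ⟨t⟩
    exact congrArg Submodule.Quotient.mk (O.comp_parallel H hij hik hl hr y z t)
  comp_one := by
    rintro r q c g σ h1 h2 i h ⟨y⟩
    exact congrArg Submodule.Quotient.mk (O.comp_one g σ h1 h2 h y)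
  one_comp := by
    rintro u q c g σ h1 i h ⟨y⟩
    exact congrArg Submodule.Quotient.mk (O.one_comp g σ h1 h y)
  d_comp := by
    rintro r u q g i i' j j' k k' hi hj hk h hl hr ⟨y⟩ ⟨z⟩
    exact congrArg Submodule.Quotient.mk (O.d_comp g hi hj hk h hl hr y z)
  d_one c j h := congrArg Submodule.Quotient.mk (O.d_one c h)

/-- The cocycles of degree `i`. -/
def cocycles (O : DGOperad.{x, u} Ξ) (q : Corolla Ξ) (i : ℤ) : Submodule ℚ (O.obj q i) :=
  LinearMap.ker (O.d (q := q) (rfl : i + 1 = i + 1))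

theorem mem_cocycles {O : DGOperad.{x, u} Ξ} {q : Corolla Ξ} {i j : ℤ} (h : i + 1 = j)
    {y : O.obj q i} : y ∈ O.cocycles q i ↔ O.d h y = 0 := by
  subst h
  exact LinearMap.mem_ker

theorem map_mem_cocycles (O : DGOperad.{x, u} Ξ) {q q' : Corolla Ξ} {i : ℤ} (σ : q.Iso q')
    {y : O.obj q i} (hy : y ∈ O.cocycles q i) : O.map σ y ∈ O.cocycles q' i := by
  rw [mem_cocycles rfl] at hy ⊢
  rw [O.d_map, hy, map_zero]

theorem comp_mem_cocycles (O : DGOperad.{x, u} Ξ) {r u q : Corolla Ξ} {i j k : ℤ}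
    (g : Graft r u q) (h : i + j = k) {y : O.obj r i} {z : O.obj u j}
    (hy : y ∈ O.cocycles r i) (hz : z ∈ O.cocycles u j) : O.comp g h y z ∈ O.cocycles q k := by
  rw [mem_cocycles rfl] at hy hz ⊢
  rw [O.d_comp g rfl rfl rfl h (by omega) (by omega), hy, hz]
  simp

/-- The operad `Z(O)` of cocycles, with the zero differential. -/
def cocycleOperad (O : DGOperad.{x, u} Ξ) : DGOperad.{x, u} Ξ where
  obj q i := O.cocycles q i
  map {q q' i} σ := (O.map σ).restrict fun _ hy => O.map_mem_cocycles σ hy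
  map_refl y := Subtype.ext (O.map_refl _)
  map_trans σ τ y := Subtype.ext (O.map_trans _ _ _)
  d _ := 0
  d_d _ _ _ := rfl
  d_map _ _ _ := by simp
  comp {r u q i j k} g h := LinearMap.mk₂ ℚ
    (fun y z => ⟨O.comp g h y.1 z.1, O.comp_mem_cocycles g h y.2 z.2⟩)
    (fun _ _ _ => Subtype.ext (by simp)) (fun _ _ _ => Subtype.ext (by simp))
    (fun _ _ _ => Subtype.ext (by simp)) (fun _ _ _ => Subtype.ext (by simp))
  one c := ⟨O.one c, (mem_cocycles rfl).2 (O.d_one c rfl)⟩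
  comp_map h H y z := Subtype.ext (O.comp_map h H _ _)
  comp_sequential H _ _ _ _ _ _ hij hjk hl hr y z t :=
    Subtype.ext (O.comp_sequential H hij hjk hl hr _ _ _)
  comp_parallel H _ _ _ _ _ _ hij hik hl hr y z t :=
    Subtype.ext (O.comp_parallel H hij hik hl hr _ _ _)
  comp_one g σ h1 h2 _ h y := Subtype.ext (O.comp_one g σ h1 h2 h _)
  one_comp g σ h1 _ h y := Subtype.ext (O.one_comp g σ h1 h _)
  d_comp g _ _ _ _ _ _ hi hj hk h hl hr y z := by
    simp
    rfl
  d_one c _ h := rfl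

/-- The ideal of coboundaries in the operad of cocycles. -/
def coboundaries (O : DGOperad.{x, u} Ξ) : O.cocycleOperad.Ideal where
  sub q i := (LinearMap.range (O.d (q := q) (sub_add_cancel i 1))).comap (O.cocycles q i).subtype
  map_mem := by
    rintro q q' i σ ⟨y, hy⟩ ⟨z, hz⟩
    exact ⟨O.map σ z, (O.d_map _ σ z).trans (congrArg (O.map σ) hz)⟩
  d_mem := by
    intro q i j h y hy
    exact Submodule.zero_mem _
  comp_mem_left := by
    rintro r u q i j k g h ⟨y, hy⟩ ⟨z, hz⟩ ⟨t, ht⟩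
    refine ⟨O.comp g (by omega) t z, ?_⟩
    rw [O.d_comp g (sub_add_cancel i 1) rfl _ _ h (by omega), (mem_cocycles rfl).1 hz]
    change O.d _ t = y at ht
    rw [ht]
    simp
    rfl
  comp_mem_right := by
    rintro r u q i j k g h ⟨y, hy⟩ ⟨z, hz⟩ ⟨t, ht⟩
    refine ⟨((-1 : ℚ) ^ i) • O.comp g (by omega) y t, ?_⟩
    rw [map_smul, O.d_comp g rfl (sub_add_cancel j 1) _ _ (by omega) h, (mem_cocycles rfl).1 hy]
    change O.d _ t = z at ht
    rw [ht, map_zero, LinearMap.zero_apply, zero_add, smul_smul, ← mul_zpow]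
    simp
    rfl

/-- The cohomology operad `H(O) = Z(O) / B(O)`, with the zero differential. -/
def cohomology (O : DGOperad.{x, u} Ξ) : DGOperad.{x, u} Ξ :=
  O.cocycleOperad.quotient O.coboundaries

/-- The projection `Z(O) → H(O)`. -/
def toCohomology (O : DGOperad.{x, u} Ξ) {q : Corolla Ξ} {i : ℤ} :
    O.cocycles q i →ₗ[ℚ] O.cohomology.obj q i :=
  (O.coboundaries.sub q i).mkQ

/-- The restriction of a morphism to cocycles. -/
def Hom.cocyclesMap {O : DGOperad.{x, u} Ξ} {Q : DGOperad.{x, v} Ξ} (F : Hom O Q)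
    (q : Corolla Ξ) (i : ℤ) : O.cocycles q i →ₗ[ℚ] Q.cocycles q i :=
  F.app.restrict fun y hy => by
    rw [mem_cocycles rfl] at hy ⊢
    rw [← F.app_d, hy, map_zero]

/-- The map induced on cohomology by a morphism. -/
def Hom.cohomologyMap {O : DGOperad.{x, u} Ξ} {Q : DGOperad.{x, v} Ξ} (F : Hom O Q)
    (q : Corolla Ξ) (i : ℤ) : O.cohomology.obj q i →ₗ[ℚ] Q.cohomology.obj q i :=
  (O.coboundaries.sub q i).mapQ (Q.coboundaries.sub q i) (F.cocyclesMap q i) (by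
    rintro ⟨y, hy⟩ ⟨z, hz⟩
    exact ⟨F.app z, (F.app_d _ z).symm.trans (congrArg F.app hz)⟩)

/-- Quasi-isomorphisms of dg operads. -/
def Hom.IsQuasiIso {O : DGOperad.{x, u} Ξ} {Q : DGOperad.{x, v} Ξ} (F : Hom O Q) : Prop :=
  ∀ (q : Corolla Ξ) (i : ℤ), Function.Bijective (F.cohomologyMap q i)

/-- Membership in the suboperad (of graded vector spaces) generated by a family of sets. -/
inductive Generated (O : DGOperad.{x, u} Ξ) (S : ∀ (q : Corolla Ξ) (i : ℤ), Set (O.obj q i)) :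
    ∀ (q : Corolla Ξ) (i : ℤ), O.obj q i → Prop
  | of {q : Corolla Ξ} {i : ℤ} {y : O.obj q i} (hy : y ∈ S q i) : Generated O S q i y
  | one (c : Ξ) : Generated O S (Corolla.unit c) 0 (O.one c)
  | zero (q : Corolla Ξ) (i : ℤ) : Generated O S q i 0
  | add {q : Corolla Ξ} {i : ℤ} {y z : O.obj q i} (hy : Generated O S q i y)
      (hz : Generated O S q i z) : Generated O S q i (y + z)
  | smul {q : Corolla Ξ} {i : ℤ} (c : ℚ) {y : O.obj q i} (hy : Generated O S q i y) :
      Generated O S q i (c • y)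
  | map {q q' : Corolla Ξ} {i : ℤ} (σ : q.Iso q') {y : O.obj q i} (hy : Generated O S q i y) :
      Generated O S q' i (O.map σ y)
  | comp {r u q : Corolla Ξ} {i j k : ℤ} (g : Graft r u q) (h : i + j = k) {y : O.obj r i}
      {z : O.obj u j} (hy : Generated O S r i y) (hz : Generated O S u j z) :
      Generated O S q k (O.comp g h y z)

end DGOperad


/-! ## The cobar construction -/

section Cobar

variable {Ξ : Type x}

/-- Formal expressions for the elements of the dg operad freely generated by the symbols `s y` of
degree `|y| + 1`, where `y` runs over the homogeneous elements of `P`. -/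
inductive FreeExpr (P : DGPseudoCooperad.{x, v} Ξ) : Corolla Ξ → ℤ → Type (max v x)
  | gen {q : Corolla Ξ} {i j : ℤ} (h : i + 1 = j) (y : P.obj q i) : FreeExpr P q j
  | one (c : Ξ) : FreeExpr P (Corolla.unit c) 0
  | map {q q' : Corolla Ξ} {i : ℤ} (σ : q.Iso q') (e : FreeExpr P q i) : FreeExpr P q' i
  | comp {r u q : Corolla Ξ} {i j k : ℤ} (g : Graft r u q) (h : i + j = k) (e : FreeExpr P r i)
      (f : FreeExpr P u j) : FreeExpr P q k
  | d {q : Corolla Ξ} {i j : ℤ} (h : i + 1 = j) (e : FreeExpr P q i) : FreeExpr P q j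
  | zero (q : Corolla Ξ) (i : ℤ) : FreeExpr P q i
  | add {q : Corolla Ξ} {i : ℤ} (e f : FreeExpr P q i) : FreeExpr P q i
  | smul {q : Corolla Ξ} {i : ℤ} (c : ℚ) (e : FreeExpr P q i) : FreeExpr P q i

open FreeExpr in
/-- The congruence on formal expressions generated by the axioms of a dg operad and by the
requirement that `y ↦ s y` is linear and commutes with the relabellings. -/
inductive FreeRel (P : DGPseudoCooperad.{x, v} Ξ) :
    ∀ {q : Corolla Ξ} {i : ℤ}, FreeExpr P q i → FreeExpr P q i → Prop
  | refl {q : Corolla Ξ} {i : ℤ} (e : FreeExpr P q i) : FreeRel P e e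
  | symm {q : Corolla Ξ} {i : ℤ} {e f : FreeExpr P q i} : FreeRel P e f → FreeRel P f e
  | trans {q : Corolla Ξ} {i : ℤ} {e f g : FreeExpr P q i} :
      FreeRel P e f → FreeRel P f g → FreeRel P e g
  | map_congr {q q' : Corolla Ξ} {i : ℤ} (σ : q.Iso q') {e f : FreeExpr P q i} :
      FreeRel P e f → FreeRel P (map σ e) (map σ f)
  | comp_congr {r u q : Corolla Ξ} {i j k : ℤ} (g : Graft r u q) (h : i + j = k)
      {e e' : FreeExpr P r i} {f f' : FreeExpr P u j} :
      FreeRel P e e' → FreeRel P f f' → FreeRel P (comp g h e f) (comp g h e' f')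
  | d_congr {q : Corolla Ξ} {i j : ℤ} (h : i + 1 = j) {e f : FreeExpr P q i} :
      FreeRel P e f → FreeRel P (d h e) (d h f)
  | add_congr {q : Corolla Ξ} {i : ℤ} {e e' f f' : FreeExpr P q i} :
      FreeRel P e e' → FreeRel P f f' → FreeRel P (add e f) (add e' f')
  | smul_congr {q : Corolla Ξ} {i : ℤ} (c : ℚ) {e f : FreeExpr P q i} :
      FreeRel P e f → FreeRel P (smul c e) (smul c f)
  -- vector spaces
  | add_comm {q : Corolla Ξ} {i : ℤ} (e f : FreeExpr P q i) : FreeRel P (add e f) (add f e)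
  | add_assoc {q : Corolla Ξ} {i : ℤ} (e f g : FreeExpr P q i) :
      FreeRel P (add (add e f) g) (add e (add f g))
  | zero_add {q : Corolla Ξ} {i : ℤ} (e : FreeExpr P q i) : FreeRel P (add (zero q i) e) e
  | smul_add {q : Corolla Ξ} {i : ℤ} (c : ℚ) (e f : FreeExpr P q i) :
      FreeRel P (smul c (add e f)) (add (smul c e) (smul c f))
  | add_smul {q : Corolla Ξ} {i : ℤ} (c c' : ℚ) (e : FreeExpr P q i) :
      FreeRel P (smul (c + c') e) (add (smul c e) (smul c' e))
  | mul_smul {q : Corolla Ξ} {i : ℤ} (c c' : ℚ) (e : FreeExpr P q i) :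
      FreeRel P (smul (c * c') e) (smul c (smul c' e))
  | one_smul {q : Corolla Ξ} {i : ℤ} (e : FreeExpr P q i) : FreeRel P (smul 1 e) e
  | zero_smul {q : Corolla Ξ} {i : ℤ} (e : FreeExpr P q i) : FreeRel P (smul 0 e) (zero q i)
  -- generators
  | gen_add {q : Corolla Ξ} {i j : ℤ} (h : i + 1 = j) (y z : P.obj q i) :
      FreeRel P (gen h (y + z)) (add (gen h y) (gen h z))
  | gen_smul {q : Corolla Ξ} {i j : ℤ} (h : i + 1 = j) (c : ℚ) (y : P.obj q i) :
      FreeRel P (gen h (c • y)) (smul c (gen h y))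
  | gen_map {q q' : Corolla Ξ} {i j : ℤ} (h : i + 1 = j) (σ : q.Iso q') (y : P.obj q i) :
      FreeRel P (gen h (P.map σ y)) (map σ (gen h y))
  -- linearity of the operations
  | map_add {q q' : Corolla Ξ} {i : ℤ} (σ : q.Iso q') (e f : FreeExpr P q i) :
      FreeRel P (map σ (add e f)) (add (map σ e) (map σ f))
  | map_smul {q q' : Corolla Ξ} {i : ℤ} (σ : q.Iso q') (c : ℚ) (e : FreeExpr P q i) :
      FreeRel P (map σ (smul c e)) (smul c (map σ e))
  | d_add {q : Corolla Ξ} {i j : ℤ} (h : i + 1 = j) (e f : FreeExpr P q i) :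
      FreeRel P (d h (add e f)) (add (d h e) (d h f))
  | d_smul {q : Corolla Ξ} {i j : ℤ} (h : i + 1 = j) (c : ℚ) (e : FreeExpr P q i) :
      FreeRel P (d h (smul c e)) (smul c (d h e))
  | comp_add_left {r u q : Corolla Ξ} {i j k : ℤ} (g : Graft r u q) (h : i + j = k)
      (e e' : FreeExpr P r i) (f : FreeExpr P u j) :
      FreeRel P (comp g h (add e e') f) (add (comp g h e f) (comp g h e' f))
  | comp_smul_left {r u q : Corolla Ξ} {i j k : ℤ} (g : Graft r u q) (h : i + j = k) (c : ℚ)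
      (e : FreeExpr P r i) (f : FreeExpr P u j) :
      FreeRel P (comp g h (smul c e) f) (smul c (comp g h e f))
  | comp_add_right {r u q : Corolla Ξ} {i j k : ℤ} (g : Graft r u q) (h : i + j = k)
      (e : FreeExpr P r i) (f f' : FreeExpr P u j) :
      FreeRel P (comp g h e (add f f')) (add (comp g h e f) (comp g h e f'))
  | comp_smul_right {r u q : Corolla Ξ} {i j k : ℤ} (g : Graft r u q) (h : i + j = k) (c : ℚ)
      (e : FreeExpr P r i) (f : FreeExpr P u j) :
      FreeRel P (comp g h e (smul c f)) (smul c (comp g h e f))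
  -- the axioms of a dg operad
  | map_refl {q : Corolla Ξ} {i : ℤ} (e : FreeExpr P q i) :
      FreeRel P (map (Corolla.Iso.refl q) e) e
  | map_trans {q q' q'' : Corolla Ξ} {i : ℤ} (σ : q.Iso q') (τ : q'.Iso q'')
      (e : FreeExpr P q i) : FreeRel P (map (σ.trans τ) e) (map τ (map σ e))
  | d_d {q : Corolla Ξ} {i j k : ℤ} (hi : i + 1 = j) (hj : j + 1 = k) (e : FreeExpr P q i) :
      FreeRel P (d hj (d hi e)) (zero q k)
  | d_map {q q' : Corolla Ξ} {i j : ℤ} (h : i + 1 = j) (σ : q.Iso q') (e : FreeExpr P q i) :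
      FreeRel P (d h (map σ e)) (map σ (d h e))
  | comp_map {r u q r' u' q' : Corolla Ξ} {i j k : ℤ} {σ : r.Iso r'} {τ : u.Iso u'}
      {κ : q.Iso q'} {g : Graft r u q} {g' : Graft r' u' q'} (h : i + j = k)
      (H : Graft.Compat σ τ κ g g') (e : FreeExpr P r i) (f : FreeExpr P u j) :
      FreeRel P (comp g' h (map σ e) (map τ f)) (map κ (comp g h e f))
  | comp_sequential {r u v w m q : Corolla Ξ} {a : Graft r w q} {b : Graft u v w}
      {c : Graft m v q} {c' : Graft r u m} (H : Graft.Sequential a b c c')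
      {i j k ij jk ijk : ℤ} (hij : i + j = ij) (hjk : j + k = jk) (hl : ij + k = ijk)
      (hr : i + jk = ijk) (e : FreeExpr P r i) (f : FreeExpr P u j) (g : FreeExpr P v k) :
      FreeRel P (comp c hl (comp c' hij e f) g) (comp a hr e (comp b hjk f g))
  | comp_parallel {r u v m m' q : Corolla Ξ} {a : Graft r u m} {b : Graft m v q}
      {c : Graft r v m'} {c' : Graft m' u q} (H : Graft.Parallel a b c c')
      {i j k ij ik ijk : ℤ} (hij : i + j = ij) (hik : i + k = ik) (hl : ij + k = ijk)
      (hr : ik + j = ijk) (e : FreeExpr P r i) (f : FreeExpr P u j) (g : FreeExpr P v k) :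
      FreeRel P (comp b hl (comp a hij e f) g)
        (smul ((-1 : ℚ) ^ (j * k)) (comp c' hr (comp c hik e g) f))
  | comp_one {r q : Corolla Ξ} {c : Ξ} (g : Graft r (Corolla.unit c) q) (σ : r.Iso q)
      (h1 : ∀ i k, g.leaf (Sum.inl i) = some k → σ.perm i = k)
      (h2 : ∀ j, g.leaf (Sum.inr j) = some (σ.perm g.leg)) {i : ℤ} (h : i + 0 = i)
      (e : FreeExpr P r i) : FreeRel P (comp g h e (one c)) (map σ e)
  | one_comp {u q : Corolla Ξ} {c : Ξ} (g : Graft (Corolla.unit c) u q) (σ : u.Iso q)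
      (h1 : ∀ j, g.leaf (Sum.inr j) = some (σ.perm j)) {i : ℤ} (h : 0 + i = i)
      (e : FreeExpr P u i) : FreeRel P (comp g h (one c) e) (map σ e)
  | d_comp {r u q : Corolla Ξ} (g : Graft r u q) {i i' j j' k k' : ℤ} (hi : i + 1 = i')
      (hj : j + 1 = j') (hk : k + 1 = k') (h : i + j = k) (hl : i' + j = k') (hr : i + j' = k')
      (e : FreeExpr P r i) (f : FreeExpr P u j) :
      FreeRel P (d hk (comp g h e f))
        (add (comp g hl (d hi e) f) (smul ((-1 : ℚ) ^ i) (comp g hr e (d hj f))))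
  | d_one (c : Ξ) {j : ℤ} (h : 0 + 1 = j) : FreeRel P (d h (one c)) (zero _ j)

/-- The setoid of the congruence `FreeRel`. -/
def freeSetoid (P : DGPseudoCooperad.{x, v} Ξ) (q : Corolla Ξ) (i : ℤ) :
    Setoid (FreeExpr P q i) :=
  ⟨FreeRel P, ⟨FreeRel.refl, FreeRel.symm, FreeRel.trans⟩⟩

/-- The components of the free dg operad. -/
def FreeObj (P : DGPseudoCooperad.{x, v} Ξ) (q : Corolla Ξ) (i : ℤ) : Type (max v x) :=
  Quotient (freeSetoid P q i)

variable (P : DGPseudoCooperad.{x, v} Ξ)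

instance FreeObj.instAdd (q : Corolla Ξ) (i : ℤ) : Add (FreeObj P q i) :=
  ⟨Quotient.map₂ FreeExpr.add fun _ _ h _ _ h' => FreeRel.add_congr h h'⟩

instance FreeObj.instZero (q : Corolla Ξ) (i : ℤ) : Zero (FreeObj P q i) :=
  ⟨Quotient.mk _ (FreeExpr.zero q i)⟩

instance FreeObj.instNeg (q : Corolla Ξ) (i : ℤ) : Neg (FreeObj P q i) :=
  ⟨Quotient.map (FreeExpr.smul (-1)) fun _ _ h => FreeRel.smul_congr _ h⟩

instance FreeObj.instAddCommGroup (q : Corolla Ξ) (i : ℤ) : AddCommGroup (FreeObj P q i) where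
  add_assoc := by
    rintro ⟨e⟩ ⟨f⟩ ⟨g⟩
    exact Quotient.sound (FreeRel.add_assoc e f g)
  add_comm := by
    rintro ⟨e⟩ ⟨f⟩
    exact Quotient.sound (FreeRel.add_comm e f)
  zero_add := by
    rintro ⟨e⟩
    exact Quotient.sound (FreeRel.zero_add e)
  add_zero := by
    rintro ⟨e⟩
    exact Quotient.sound ((FreeRel.add_comm _ _).trans (FreeRel.zero_add e))
  neg_add_cancel := by
    rintro ⟨e⟩
    refine Quotient.sound (((FreeRel.add_congr (FreeRel.refl _) (FreeRel.one_smul e).symm).trans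
      (FreeRel.add_smul (-1) 1 e).symm).trans ?_)
    rw [neg_add_cancel]
    exact FreeRel.zero_smul e
  nsmul := nsmulRec
  zsmul := zsmulRec

instance FreeObj.instModule (q : Corolla Ξ) (i : ℤ) : Module ℚ (FreeObj P q i) where
  smul c := Quotient.map (FreeExpr.smul c) fun _ _ h => FreeRel.smul_congr c h
  one_smul := by
    rintro ⟨e⟩
    exact Quotient.sound (FreeRel.one_smul e)
  mul_smul := by
    rintro c c' ⟨e⟩
    exact Quotient.sound (FreeRel.mul_smul c c' e)
  smul_zero c := by
    refine Quotient.sound ((FreeRel.smul_congr c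
      (FreeRel.zero_smul (FreeExpr.zero q i)).symm).trans ?_)
    refine (FreeRel.mul_smul c 0 (FreeExpr.zero q i)).symm.trans ?_
    rw [mul_zero]
    exact FreeRel.zero_smul _
  smul_add := by
    rintro c ⟨e⟩ ⟨f⟩
    exact Quotient.sound (FreeRel.smul_add c e f)
  add_smul := by
    rintro c c' ⟨e⟩
    exact Quotient.sound (FreeRel.add_smul c c' e)
  zero_smul := by
    rintro ⟨e⟩
    exact Quotient.sound (FreeRel.zero_smul e)

/-- The dg operad freely generated by the symbols `s y` of degree `|y| + 1`, where `y` runs over the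
homogeneous elements of `P` and `s y` depends linearly on `y` and commutes with the relabellings. -/
def freeDGOperad : DGOperad.{x, max v x} Ξ where
  obj := FreeObj P
  map {q q' i} σ :=
    { toFun := Quotient.map (FreeExpr.map σ) fun _ _ h => FreeRel.map_congr σ h
      map_add' := by
        rintro ⟨e⟩ ⟨f⟩
        exact Quotient.sound (FreeRel.map_add σ e f)
      map_smul' := by
        rintro c ⟨e⟩
        exact Quotient.sound (FreeRel.map_smul σ c e) }
  map_refl := by
    rintro q i ⟨e⟩
    exact Quotient.sound (FreeRel.map_refl e)
  map_trans := by
    rintro q q' q'' i σ τ ⟨e⟩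
    exact Quotient.sound (FreeRel.map_trans σ τ e)
  d {q i j} h :=
    { toFun := Quotient.map (FreeExpr.d h) fun _ _ h' => FreeRel.d_congr h h'
      map_add' := by
        rintro ⟨e⟩ ⟨f⟩
        exact Quotient.sound (FreeRel.d_add h e f)
      map_smul' := by
        rintro c ⟨e⟩
        exact Quotient.sound (FreeRel.d_smul h c e) }
  d_d := by
    rintro q i j k hi hj ⟨e⟩
    exact Quotient.sound (FreeRel.d_d hi hj e)
  d_map := by
    rintro q q' i j h σ ⟨e⟩
    exact Quotient.sound (FreeRel.d_map h σ e)
  comp {r u q i j k} g h := LinearMap.mk₂ ℚ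
    (Quotient.map₂ (FreeExpr.comp g h) fun _ _ h1 _ _ h2 => FreeRel.comp_congr g h h1 h2)
    (by
      rintro ⟨e⟩ ⟨e'⟩ ⟨f⟩
      exact Quotient.sound (FreeRel.comp_add_left g h e e' f))
    (by
      rintro c ⟨e⟩ ⟨f⟩
      exact Quotient.sound (FreeRel.comp_smul_left g h c e f))
    (by
      rintro ⟨e⟩ ⟨f⟩ ⟨f'⟩
      exact Quotient.sound (FreeRel.comp_add_right g h e f f'))
    (by
      rintro c ⟨e⟩ ⟨f⟩
      exact Quotient.sound (FreeRel.comp_smul_right g h c e f))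
  one c := Quotient.mk _ (FreeExpr.one c)
  comp_map := by
    rintro r u q r' u' q' i j k σ τ κ g g' h H ⟨e⟩ ⟨f⟩
    exact Quotient.sound (FreeRel.comp_map h H e f)
  comp_sequential := by
    rintro r u v w m q a b c c' H i j k ij jk ijk hij hjk hl hr ⟨e⟩ ⟨f⟩ ⟨g⟩
    exact Quotient.sound (FreeRel.comp_sequential H hij hjk hl hr e f g)
  comp_parallel := by
    rintro r u v m m' q a b c c' H i j k ij ik ijk hij hik hl hr ⟨e⟩ ⟨f⟩ ⟨g⟩
    exact Quotient.sound (FreeRel.comp_parallel H hij hik hl hr e f g)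
  comp_one := by
    rintro r q c g σ h1 h2 i h ⟨e⟩
    exact Quotient.sound (FreeRel.comp_one g σ h1 h2 h e)
  one_comp := by
    rintro u q c g σ h1 i h ⟨e⟩
    exact Quotient.sound (FreeRel.one_comp g σ h1 h e)
  d_comp := by
    rintro r u q g i i' j j' k k' hi hj hk h hl hr ⟨e⟩ ⟨f⟩
    exact Quotient.sound (FreeRel.d_comp g hi hj hk h hl hr e f)
  d_one c j h := Quotient.sound (FreeRel.d_one c h)

/-- The tautological element `y ↦ s y` of degree one. -/
def freeGenerator : Conv P (freeDGOperad P) 1 :=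
  ⟨fun _ _ =>
    { toFun := fun y => Quotient.mk _ (FreeExpr.gen rfl y)
      map_add' := fun y z => Quotient.sound (FreeRel.gen_add rfl y z)
      map_smul' := fun c y => Quotient.sound (FreeRel.gen_smul rfl c y) },
    fun _ _ _ σ y => Quotient.sound (FreeRel.gen_map rfl σ y)⟩

/-- Membership in the dg ideal generated by the elements
`Curv(s)(y) = ∂(s y) + s(∂y) + (s • s)(y)`. -/
inductive CobarIdealMem : ∀ (q : Corolla Ξ) (i : ℤ), (freeDGOperad P).obj q i → Prop
  | curv {q : Corolla Ξ} {i j : ℤ} (h : i + 2 = j) (y : P.obj q i) :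
      CobarIdealMem q j (Conv.app (Conv.curv (freeGenerator P)) h y)
  | zero (q : Corolla Ξ) (i : ℤ) : CobarIdealMem q i 0
  | add {q : Corolla Ξ} {i : ℤ} {e f : (freeDGOperad P).obj q i} (he : CobarIdealMem q i e)
      (hf : CobarIdealMem q i f) : CobarIdealMem q i (e + f)
  | smul {q : Corolla Ξ} {i : ℤ} (c : ℚ) {e : (freeDGOperad P).obj q i}
      (he : CobarIdealMem q i e) : CobarIdealMem q i (c • e)
  | map {q q' : Corolla Ξ} {i : ℤ} (σ : q.Iso q') {e : (freeDGOperad P).obj q i}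
      (he : CobarIdealMem q i e) : CobarIdealMem q' i ((freeDGOperad P).map σ e)
  | d {q : Corolla Ξ} {i j : ℤ} (h : i + 1 = j) {e : (freeDGOperad P).obj q i}
      (he : CobarIdealMem q i e) : CobarIdealMem q j ((freeDGOperad P).d h e)
  | comp_left {r u q : Corolla Ξ} {i j k : ℤ} (g : Graft r u q) (h : i + j = k)
      {e : (freeDGOperad P).obj r i} (f : (freeDGOperad P).obj u j) (he : CobarIdealMem r i e) :
      CobarIdealMem q k ((freeDGOperad P).comp g h e f)
  | comp_right {r u q : Corolla Ξ} {i j k : ℤ} (g : Graft r u q) (h : i + j = k)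
      (e : (freeDGOperad P).obj r i) {f : (freeDGOperad P).obj u j} (hf : CobarIdealMem u j f) :
      CobarIdealMem q k ((freeDGOperad P).comp g h e f)

/-- The dg ideal generated by the elements `∂(s y) + s(∂y) + (s • s)(y)`. -/
def cobarIdeal : (freeDGOperad P).Ideal where
  sub q i :=
    { carrier := {e | CobarIdealMem P q i e}
      add_mem' := fun he hf => CobarIdealMem.add he hf
      zero_mem' := CobarIdealMem.zero q i
      smul_mem' := fun c _ he => CobarIdealMem.smul c he }
  map_mem σ _ he := CobarIdealMem.map σ he
  d_mem h _ he := CobarIdealMem.d h he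
  comp_mem_left g h _ f he := CobarIdealMem.comp_left g h f he
  comp_mem_right g h e _ hf := CobarIdealMem.comp_right g h e hf

/-- The cobar construction `Cobar(P^◇)`: the dg operad generated by the suspension `s P`, whose
differential is prescribed on the generators by
`∂(s y) = - s(∂y) - ∑ (-1)^|y'| s y' ∘_t s y''`, where the sum runs over the isomorphism classes of
labelled trees `t` with two nodal vertices and `Δ_t y = ∑ y' ⊗ y''`. By the axioms of a dg
pseudo-cooperad the derivation of the free graded operad on `s P` with these values squares to zero,
so that this dg operad is the free graded operad on `s P` with that differential. -/
def Cobar : DGOperad.{x, max v x} Ξ := (freeDGOperad P).quotient (cobarIdeal P)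

/-- The tautological element `y ↦ s y` of `Conv(P, Cobar(P^◇))`. -/
def cobarGenerator : Conv P (Cobar P) 1 :=
  ⟨fun q i => ((cobarIdeal P).sub q (i + 1)).mkQ ∘ₗ (freeGenerator P).1 q i,
    fun q q' i σ y => congrArg ((cobarIdeal P).sub q' (i + 1)).mkQ ((freeGenerator P).2 q q' i σ y)⟩

variable {P}

/-- The element `y ↦ ρ(s y)` of `Conv(P, Q)` corresponding to a morphism `ρ : Cobar(P^◇) → Q`. -/
def DGOperad.Hom.toConv {Q : DGOperad.{x, u} Ξ} (ρ : (Cobar P).Hom Q) : Conv P Q 1 :=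
  ⟨fun q i => ρ.app ∘ₗ (cobarGenerator P).1 q i, fun q q' i σ y =>
    (congrArg ρ.app ((cobarGenerator P).2 q q' i σ y)).trans (ρ.app_map σ _)⟩

end Cobar

/-! ## Weight gradings and sprouts -/

section Sprouts

variable {Ξ : Type x}

/-- An additional grading `P = ⨁_{k ≥ 1} G^k P` of a dg pseudo-cooperad by subcollections, such that
`∂(G^{k+1} P) ⊆ G^k P` and `Δ_t(G^n P) ⊆ ⨁_{a + b = n} G^a P ⊗ G^b P` for every tree `t` with two
nodal vertices. -/
structure WeightGrading (P : DGPseudoCooperad.{x, v} Ξ) where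
  part : ℕ → ∀ (q : Corolla Ξ) (i : ℤ), Submodule ℚ (P.obj q i)
  isInternal : ∀ (q : Corolla Ξ) (i : ℤ), DirectSum.IsInternal fun k => part k q i
  part_zero : ∀ (q : Corolla Ξ) (i : ℤ), part 0 q i = ⊥
  map_mem : ∀ {k : ℕ} {q q' : Corolla Ξ} {i : ℤ} (σ : q.Iso q') {y : P.obj q i},
    y ∈ part k q i → P.map σ y ∈ part k q' i
  d_mem : ∀ {k : ℕ} {q : Corolla Ξ} {i j : ℤ} (h : i + 1 = j) {y : P.obj q i},
    y ∈ part (k + 1) q i → P.d h y ∈ part k q j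
  cocomp_mem : ∀ {n : ℕ} {r u q : Corolla Ξ} {i j k : ℤ} (g : Graft r u q) (h : i + j = k)
    {y : P.obj q k}, y ∈ part n q k →
    P.cocomp g h y ∈ ⨆ p ∈ Finset.HasAntidiagonal.antidiagonal n,
      LinearMap.range (TensorProduct.map (part p.1 r i).subtype (part p.2 u j).subtype)

/-- The ascending filtration `F^m P = ⨁_{k ≤ m} G^k P`. -/
def WeightGrading.filtration {P : DGPseudoCooperad.{x, v} Ξ} (G : WeightGrading P) (m : ℕ)
    (q : Corolla Ξ) (i : ℤ) : Submodule ℚ (P.obj q i) :=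
  ⨆ k ∈ Set.Iic m, G.part k q i

/-- Every `G^k P` is finite dimensional (in total, over all corollas and degrees). -/
def WeightGrading.FiniteParts {P : DGPseudoCooperad.{x, v} Ξ} (G : WeightGrading P) : Prop :=
  ∀ k : ℕ, (∀ (q : Corolla Ξ) (i : ℤ), Module.Finite ℚ (G.part k q i)) ∧
    {p : Corolla Ξ × ℤ | G.part k p.1 p.2 ≠ ⊥}.Finite

/-- The descending filtration on `Conv(P, O)`: the space `F_{m+1} Conv(P, O)` of the elements
vanishing on `F^m P`. -/
def Conv.filtrationSucc {P : DGPseudoCooperad.{x, v} Ξ} {O : DGOperad.{x, u} Ξ}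
    (G : WeightGrading P) (m : ℕ) (a : ℤ) : Set (Conv P O a) :=
  {f | ∀ (q : Corolla Ξ) (i j : ℤ) (h : i + a = j), ∀ y ∈ G.filtration m q i, Conv.app f h y = 0}

/-- An `n`-th MC-sprout: a degree one element `α` with `Curv(α) ∈ F_{n+1} Conv(P, O)`. -/
def IsMCSprout {P : DGPseudoCooperad.{x, v} Ξ} {O : DGOperad.{x, u} Ξ} (G : WeightGrading P)
    (n : ℕ) (α : Conv P O 1) : Prop :=
  Conv.curv α ∈ Conv.filtrationSucc G n 2

end Sprouts

/-! Since `φ` is bijective, the projection `π` from the cocycles of `O` to `H` is surjective.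
Relabellings between two corollas form a finite set and the ground field is `ℚ`, so averaging gives
an equivariant section `s` of `π`. It need not respect composition. Let `β` be `s ∘ α_H` in weight
one and zero in all other weights. Its values are cocycles, and `π ∘ β = α_H` on all of `P`, because
`α_H` vanishes in weights at least two.

Curvature is natural under morphisms of dg operads (`Conv.curv_push`), so `π` sends `Curv(β)` to
`Curv(α_H)`, which is zero because the relations of the cobar construction are the Maurer-Cartan
equation (`curv_cobarGenerator`). Hence the failure of `s` to be multiplicative is exact: every
value of `Curv(β)` is a coboundary. Choose an equivariant `t` that inverts the differential of `O`
on coboundaries, and put `α = β - t ∘ Curv(β)` in weight two, with `α = β` elsewhere.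

The weights make this correction clean. In weight one, `∂_P` and the comultiplications vanish, so
the curvature is the differential of a cocycle, hence zero (`Conv.curv_of_mem_part_one`). In weight
two, `∂_P` and the comultiplications involve weight one only, where `α = β`; so the curvature
changes by `d(α - β) = -d t Curv(β) = -Curv(β)` and becomes zero (`Conv.curv_of_mem_part_two`). -/

/-! ### Relabellings and representatives of corollas. -/

namespace Corolla

variable {Ξ : Type x}

theorem Iso.ext' {q q' : Corolla Ξ} {σ τ : q.Iso q'} (h : σ.perm = τ.perm) : σ = τ := by
  cases σ
  cases τ
  cases h
  rfl

instance Iso.instFinite (q q' : Corolla Ξ) : Finite (q.Iso q') :=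
  Finite.of_injective Iso.perm fun _ _ => Iso.ext'

/-- Postcomposition with a relabelling is a bijection. -/
def Iso.transEquiv (p : Corolla Ξ) {q q' : Corolla Ξ} (κ : q.Iso q') : p.Iso q ≃ p.Iso q' where
  toFun σ := σ.trans κ
  invFun σ := σ.trans κ.symm
  left_inv σ := Iso.ext' (by ext; simp [Iso.trans, Iso.symm])
  right_inv σ := Iso.ext' (by ext; simp [Iso.trans, Iso.symm])

/-- Isomorphism of corollas. -/
instance isoSetoid : Setoid (Corolla Ξ) :=
  ⟨fun q q' => Nonempty (q.Iso q'), ⟨fun q => ⟨Iso.refl q⟩, fun ⟨σ⟩ => ⟨σ.symm⟩,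
    fun ⟨σ⟩ ⟨τ⟩ => ⟨σ.trans τ⟩⟩⟩

/-- A representative of the isomorphism class of a corolla. -/
noncomputable def rep (q : Corolla Ξ) : Corolla Ξ := (Quotient.mk isoSetoid q).out

/-- A literal equality, not just an isomorphism: averages formed at isomorphic corollas then start
from the same linear map. -/
theorem rep_eq {q q' : Corolla Ξ} (σ : q.Iso q') : q.rep = q'.rep :=
  congrArg Quotient.out (Quotient.sound (s := isoSetoid) ⟨σ⟩)

theorem nonempty_rep_iso (q : Corolla Ξ) : Nonempty (q.rep.Iso q) :=
  Quotient.exact (s := isoSetoid) (Quotient.out_eq _)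

end Corolla

/-! ### Equivariant pseudo-inverses of linear maps. -/

/-- Project the target onto the range of `f`, then apply a section of `f` over its range. The
identity `f s f = f` gives a section when `f` is surjective and a choice of primitives when `f` is a
differential; being affine in `s`, it survives averaging. -/
theorem LinearMap.exists_pseudoinverse {V : Type u} {W : Type v} [AddCommGroup V] [Module ℚ V]
    [AddCommGroup W] [Module ℚ W] (f : V →ₗ[ℚ] W) :
    ∃ s : W →ₗ[ℚ] V, ∀ y, f (s (f y)) = f y := by
  obtain ⟨s, hs⟩ := f.rangeRestrict.exists_rightInverse_of_surjective f.range_rangeRestrict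
  obtain ⟨p, hp⟩ := (LinearMap.range f).subtype.exists_leftInverse_of_injective
    (Submodule.ker_subtype _)
  refine ⟨s ∘ₗ p, fun y => ?_⟩
  have h1 : p (f y) = f.rangeRestrict y := LinearMap.congr_fun hp (f.rangeRestrict y)
  have h2 := LinearMap.congr_fun hs (f.rangeRestrict y)
  simpa [h1] using congrArg Subtype.val h2

namespace DGCollection

variable {Ξ : Type x} (A : DGCollection.{x, u} Ξ)

theorem map_symm_map {q q' : Corolla Ξ} {i : ℤ} (σ : q.Iso q') (y : A.obj q i) :
    A.map σ.symm (A.map σ y) = y := by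
  rw [← A.map_trans, Corolla.Iso.ext' (σ := σ.trans σ.symm) (τ := Corolla.Iso.refl q)
    (by ext; simp [Corolla.Iso.trans, Corolla.Iso.symm, Corolla.Iso.refl]), A.map_refl]

theorem map_map_symm {q q' : Corolla Ξ} {i : ℤ} (σ : q.Iso q') (y : A.obj q' i) :
    A.map σ (A.map σ.symm y) = y :=
  A.map_symm_map σ.symm y

/-- An equivariant family of linear maps of rational representations has an equivariant
pseudo-inverse, obtained by averaging over the relabellings. -/
theorem exists_equivariant_pseudoinverse {A : DGCollection.{x, u} Ξ} {B : DGCollection.{x, v} Ξ}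
    {i j : ℤ} (f : ∀ q : Corolla Ξ, A.obj q i →ₗ[ℚ] B.obj q j)
    (hf : ∀ (q q' : Corolla Ξ) (σ : q.Iso q') (y : A.obj q i),
      f q' (A.map σ y) = B.map σ (f q y)) :
    ∃ s : ∀ q : Corolla Ξ, B.obj q j →ₗ[ℚ] A.obj q i,
      (∀ (q q' : Corolla Ξ) (σ : q.Iso q') (z : B.obj q j),
        s q' (B.map σ z) = A.map σ (s q z)) ∧
      ∀ (q : Corolla Ξ) (y : A.obj q i), f q (s q (f q y)) = f q y := by
  classical
  choose s hs using fun q => (f q).exists_pseudoinverse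
  let _ : ∀ q q' : Corolla Ξ, Fintype (q.Iso q') := fun q q' => Fintype.ofFinite _
  -- The pseudo-inverse chosen at `p` is transported to `q` along every relabelling, and the results
  -- are averaged. Only the case where `p` is the representative of `q` is used.
  let avg : ∀ p q : Corolla Ξ, B.obj q j →ₗ[ℚ] A.obj q i := fun p q =>
    (Fintype.card (p.Iso q) : ℚ)⁻¹ •
      ∑ σ : p.Iso q, A.map σ ∘ₗ s p ∘ₗ B.map (i := j) σ.symm
  have havg : ∀ (p q : Corolla Ξ) (z : B.obj q j), avg p q z =
      (Fintype.card (p.Iso q) : ℚ)⁻¹ • ∑ σ : p.Iso q, A.map σ (s p (B.map σ.symm z)) := by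
    intro p q z
    simp [avg, LinearMap.sum_apply]
  refine ⟨fun q => avg q.rep q, fun q q' κ z => ?_, fun q y => ?_⟩
  · simp only
    -- Equivariance: composing with `κ` permutes the summands, so the sum at `q'` is reindexed by
    -- the relabellings into `q`.
    rw [← Corolla.rep_eq κ, havg, havg, map_smul, map_sum,
      ← Fintype.card_congr (Corolla.Iso.transEquiv q.rep κ),
      ← (Corolla.Iso.transEquiv q.rep κ).sum_comp]
    congr 1
    refine Finset.sum_congr rfl fun σ _ => ?_
    change A.map (σ.trans κ) (s _ (B.map (σ.trans κ).symm _)) = _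
    rw [A.map_trans, show (σ.trans κ).symm = κ.symm.trans σ.symm from Corolla.Iso.ext' rfl,
      B.map_trans, B.map_symm_map]
  · have : Nonempty (q.rep.Iso q) := q.nonempty_rep_iso
    simp only [havg, map_smul, map_sum]
    -- Each transported map is already a pseudo-inverse at `q`, by equivariance of `f`; hence so is
    -- the mean. The set of relabellings is nonempty, so dividing by its cardinality is harmless.
    have h : ∀ σ : q.rep.Iso q,
        f q (A.map σ (s q.rep (B.map σ.symm (f q y)))) = f q y := by
      intro σ
      rw [← hf, hf _ _ σ, hs, ← hf, A.map_map_symm]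
    simp only [h, Finset.sum_const, Finset.card_univ, ← Nat.cast_smul_eq_nsmul ℚ, smul_smul]
    rw [inv_mul_cancel₀ (Nat.cast_ne_zero.2 Fintype.card_ne_zero), one_smul]

end DGCollection

/-! ### Naturality of the curvature under morphisms of dg operads. -/

namespace DGOperad

variable {Ξ : Type x}

/-- The inclusion of the operad of cocycles. -/
def cocyclesIncl (O : DGOperad.{x, u} Ξ) : Hom O.cocycleOperad O where
  app {q i} := (O.cocycles q i).subtype
  app_map _ _ := rfl
  app_d h y := ((mem_cocycles h).1 y.2).symm
  app_one _ := rfl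
  app_comp _ _ _ _ := rfl

/-- The projection to the quotient by a dg ideal. -/
def quotientHom (O : DGOperad.{x, u} Ξ) (I : O.Ideal) : Hom O (O.quotient I) where
  app {q i} := (I.sub q i).mkQ
  app_map _ _ := rfl
  app_d _ _ := rfl
  app_one _ := rfl
  app_comp _ _ _ _ := rfl

/-- Composition of morphisms. -/
def Hom.comp {O : DGOperad.{x, u} Ξ} {Q : DGOperad.{x, v} Ξ} {R : DGOperad.{x, w} Ξ}
    (F : Hom Q R) (E : Hom O Q) : Hom O R where
  app := F.app ∘ₗ E.app
  app_map σ y := by simp [E.app_map, F.app_map]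
  app_d h y := by simp [E.app_d, F.app_d]
  app_one c := by simp [E.app_one, F.app_one]
  app_comp g h y z := by simp [E.app_comp, F.app_comp]

end DGOperad

namespace Conv

variable {Ξ : Type x} {P : DGPseudoCooperad.{x, v} Ξ} {O : DGOperad.{x, u} Ξ}
  {Q : DGOperad.{x, w} Ξ}

/-- The map of convolution Lie algebras induced by a morphism of dg operads. -/
def push (F : O.Hom Q) {a : ℤ} (f : Conv P O a) : Conv P Q a :=
  ⟨fun q i => F.app ∘ₗ f.1 q i, fun q q' i σ y =>
    (congrArg F.app (f.2 q q' i σ y)).trans (F.app_map σ _)⟩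

theorem push_app (F : O.Hom Q) {a : ℤ} (f : Conv P O a) {q : Corolla Ξ} {i j : ℤ}
    (h : i + a = j) (y : P.obj q i) : app (push F f) h y = F.app (app f h y) := by
  subst h
  rfl

theorem preLieTerm_push (F : O.Hom Q) {a b c : ℤ} (hc : a + b = c) (f : Conv P O a)
    (g : Conv P O b) {q : Corolla Ξ} (t : TwoTree q) (i : ℤ) {k l : ℤ} (h : k + c = l)
    (y : P.obj q k) :
    preLieTerm hc (push F f) (push F g) t i h y = F.app (preLieTerm hc f g t i h y) := by
  simp only [preLieTerm, LinearMap.smul_apply, LinearMap.comp_apply, map_smul]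
  congr 1
  induction P.cocomp t.graft (add_sub_cancel i k) y using TensorProduct.induction_on with
  | zero => simp
  | tmul y z => simp [push_app, F.app_comp]
  | add y z hy hz => simp only [map_add, hy, hz]

theorem preLie_apply {a b c : ℤ} (hc : a + b = c) (f : Conv P O a) (g : Conv P O b)
    {q : Corolla Ξ} {k : ℤ} (y : P.obj q k) : (preLie hc f g).1 q k y =
      ∑ᶠ p : TwoTree.Class q × ℤ, preLieTerm hc f g p.1.out p.2 rfl y :=
  rfl

/-- In degree one both signs equal `-1`: the bracket of `α` with itself is twice `α • α`, which
cancels the factor one half, and the term with `∂_P` enters with a plus sign. -/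
theorem curv_apply (α : Conv P O 1) {q : Corolla Ξ} {i : ℤ} (y : P.obj q i) :
    (curv α).1 q i y = O.d (show (i + 1) + 1 = i + 2 by omega) (α.1 q i y) +
      app α (show (i + 1) + 1 = i + 2 by omega) (P.d rfl y) +
      (preLie (show (1 : ℤ) + 1 = 2 by norm_num) α α).1 q i y := by
  have h : ((-1 : ℚ) ^ ((1 : ℤ) * 1)) = -1 := by norm_num
  have h1 : ((-1 : ℚ) ^ (1 : ℤ)) = -1 := by norm_num
  have hb : bracket (show (1 : ℤ) + 1 = 2 by norm_num) α α =
      (2 : ℚ) • preLie (show (1 : ℤ) + 1 = 2 by norm_num) α α := by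
    rw [bracket, h, two_smul]
    module
  rw [curv, hb, smul_smul, show (1 / 2 : ℚ) * 2 = 1 by norm_num, one_smul]
  change (O.d _ (α.1 q i y) - ((-1 : ℚ) ^ (1 : ℤ)) • app α _ (P.d rfl y)) + _ = _
  rw [h1]
  module

/-- The curvature uses only the differential and the compositions of the target operad, and `F`
preserves both. Finiteness of the support lets `F` pass through the sum over trees. -/
theorem curv_push (F : O.Hom Q) (f : Conv P O 1) : curv (push F f) = push F (curv f) := by
  refine Subtype.ext (funext fun q => funext fun i => LinearMap.ext fun y => ?_)
  change _ = F.app ((curv f).1 q i y)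
  rw [curv_apply, curv_apply, map_add, map_add, push_app, F.app_d, preLie_apply, preLie_apply]
  congr 1
  refine Eq.trans ?_ (F.app.toAddMonoidHom.map_finsum
    (finite_support_preLieTerm _ f f rfl y)).symm
  exact finsum_congr fun p => preLieTerm_push F _ f f p.1.out p.2 rfl y

end Conv

/-! ### The Maurer-Cartan equation for morphisms out of the cobar construction. -/

section Cobar

variable {Ξ : Type x} {P : DGPseudoCooperad.{x, v} Ξ}

theorem Conv.push_zero {O : DGOperad.{x, u} Ξ} {Q : DGOperad.{x, w} Ξ} (F : O.Hom Q) (a : ℤ) :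
    Conv.push F (0 : Conv P O a) = 0 :=
  Subtype.ext (funext fun _ => funext fun _ => LinearMap.ext fun _ => map_zero F.app)

/-- The values of the curvature of the free generator are exactly the generators of the ideal that
is divided out. -/
theorem curv_cobarGenerator : Conv.curv (cobarGenerator P) = 0 := by
  refine (Conv.curv_push ((freeDGOperad P).quotientHom (cobarIdeal P)) (freeGenerator P)).trans ?_
  refine Subtype.ext (funext fun q => funext fun i => LinearMap.ext fun y => ?_)
  exact (Submodule.Quotient.mk_eq_zero _).2 (CobarIdealMem.curv rfl y)

theorem DGOperad.Hom.curv_toConv {Q : DGOperad.{x, u} Ξ} (ρ : (Cobar P).Hom Q) :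
    Conv.curv ρ.toConv = 0 := by
  refine (Conv.curv_push ρ (cobarGenerator P)).trans ?_
  rw [curv_cobarGenerator, Conv.push_zero]

end Cobar

/-! ### Projections to the weight components. -/

namespace WeightGrading

variable {Ξ : Type x} {P : DGPseudoCooperad.{x, v} Ξ} (G : WeightGrading P)

/-- The elements of the parts span everything. -/
theorem induction_part {q : Corolla Ξ} {i : ℤ} {motive : P.obj q i → Prop}
    (zero : motive 0) (add : ∀ y z, motive y → motive z → motive (y + z))
    (mem : ∀ k, ∀ y ∈ G.part k q i, motive y) (y : P.obj q i) : motive y := by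
  have hy : y ∈ ⨆ k, G.part k q i := by
    rw [(G.isInternal q i).submodule_iSup_eq_top]
    trivial
  exact Submodule.iSup_induction _ (motive := motive) hy mem zero add

/-- The projection to the part of weight `m`. -/
noncomputable def proj (m : ℕ) (q : Corolla Ξ) (i : ℤ) : P.obj q i →ₗ[ℚ] P.obj q i :=
  (G.part m q i).subtype ∘ₗ DirectSum.component ℚ ℕ (fun k => G.part k q i) m ∘ₗ
    (LinearEquiv.ofBijective (DirectSum.coeLinearMap fun k => G.part k q i)
      (G.isInternal q i)).symm.toLinearMap

variable {G}

theorem eq_zero_of_mem_part_zero {q : Corolla Ξ} {i : ℤ} {y : P.obj q i}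
    (hy : y ∈ G.part 0 q i) : y = 0 := by
  rwa [G.part_zero, Submodule.mem_bot] at hy

theorem decompose_symm {k : ℕ} {q : Corolla Ξ} {i : ℤ} {y : P.obj q i} (hy : y ∈ G.part k q i) :
    (LinearEquiv.ofBijective (DirectSum.coeLinearMap fun k => G.part k q i)
      (G.isInternal q i)).symm y = DirectSum.lof ℚ ℕ (fun k => G.part k q i) k ⟨y, hy⟩ := by
  rw [LinearEquiv.symm_apply_eq]
  exact (DirectSum.coeLinearMap_lof (fun k => G.part k q i) k ⟨y, hy⟩).symm

theorem proj_of_mem {m : ℕ} {q : Corolla Ξ} {i : ℤ} {y : P.obj q i} (hy : y ∈ G.part m q i) :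
    G.proj m q i y = y := by
  simp [proj, decompose_symm hy, DirectSum.component.lof_self]

theorem proj_of_mem_ne {m k : ℕ} (hk : k ≠ m) {q : Corolla Ξ} {i : ℤ} {y : P.obj q i}
    (hy : y ∈ G.part k q i) : G.proj m q i y = 0 := by
  simp [proj, decompose_symm hy, DirectSum.component.of, hk]

/-- Truncating to a single weight therefore keeps a family equivariant, so that it is still an
element of `Conv`. -/
theorem proj_map (m : ℕ) {q q' : Corolla Ξ} {i : ℤ} (σ : q.Iso q') (y : P.obj q i) :
    G.proj m q' i (P.map σ y) = P.map σ (G.proj m q i y) := by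
  induction y using G.induction_part with
  | zero => simp
  | add y z hy hz => simp only [map_add, hy, hz]
  | mem k y hy =>
    by_cases hk : k = m
    · subst hk
      rw [proj_of_mem hy, proj_of_mem (G.map_mem σ hy)]
    · rw [proj_of_mem_ne hk hy, proj_of_mem_ne hk (G.map_mem σ hy), map_zero]

end WeightGrading

/-! ### The curvature in weights one and two. -/

namespace Conv

variable {Ξ : Type x} {P : DGPseudoCooperad.{x, v} Ξ} {O : DGOperad.{x, u} Ξ}
  {G : WeightGrading P}

theorem app_congr_on {a : ℤ} {f f' : Conv P O a} {k : ℕ}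
    (hf : ∀ (q : Corolla Ξ) (i : ℤ), ∀ y ∈ G.part k q i, f.1 q i y = f'.1 q i y)
    {q : Corolla Ξ} {i j : ℤ} (h : i + a = j) {y : P.obj q i} (hy : y ∈ G.part k q i) :
    app f h y = app f' h y := by
  subst h
  exact hf q i y hy

/-- On the elements of weight `n`, the product `f • g` depends only on the tensors `f y ⊗ g z`
with `y` and `z` of weights with sum `n`. -/
theorem preLie_congr_on {n : ℕ} {a b c : ℤ} (hc : a + b = c) {f f' : Conv P O a}
    {g g' : Conv P O b}
    (hfg : ∀ k l : ℕ, k + l = n → ∀ (r u : Corolla Ξ) (i j : ℤ), ∀ y ∈ G.part k r i,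
      ∀ z ∈ G.part l u j, f.1 r i y ⊗ₜ[ℚ] g.1 u j z = f'.1 r i y ⊗ₜ[ℚ] g'.1 u j z)
    {q : Corolla Ξ} {i : ℤ} {y : P.obj q i} (hy : y ∈ G.part n q i) :
    (preLie hc f g).1 q i y = (preLie hc f' g').1 q i y := by
  rw [preLie_apply, preLie_apply]
  refine finsum_congr fun p => ?_
  -- The tensors on which the two maps agree form a subspace, so it suffices to test pure tensors of
  -- weights `m.1` and `m.2`. Comparing tensors rather than factors allows for the case where one
  -- factor is zero and the other is arbitrary.
  have hle : (⨆ m ∈ Finset.HasAntidiagonal.antidiagonal n, LinearMap.range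
      (TensorProduct.map (G.part m.1 p.1.out.lower p.2).subtype
        (G.part m.2 p.1.out.upper (i - p.2)).subtype)) ≤
      LinearMap.eqLocus (TensorProduct.map (f.1 p.1.out.lower p.2) (g.1 p.1.out.upper (i - p.2)))
        (TensorProduct.map (f'.1 p.1.out.lower p.2) (g'.1 p.1.out.upper (i - p.2))) := by
    refine iSup₂_le fun m hm => ?_
    rintro _ ⟨t, rfl⟩
    induction t using TensorProduct.induction_on with
    | zero => simp
    | tmul s t =>
      exact hfg m.1 m.2 (Finset.HasAntidiagonal.mem_antidiagonal.1 hm) _ _ _ _ s.1 s.2 t.1 t.2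
    | add s t hs ht =>
      rw [map_add]
      exact add_mem hs ht
  have h := hle (G.cocomp_mem p.1.out.graft (add_sub_cancel p.2 i) hy)
  simp only [preLieTerm, LinearMap.smul_apply, LinearMap.comp_apply]
  exact congrArg _ (congrArg _ h)

theorem preLie_zero {a b c : ℤ} (hc : a + b = c) :
    preLie hc (0 : Conv P O a) (0 : Conv P O b) = 0 := by
  refine Subtype.ext (funext fun q => funext fun i => LinearMap.ext fun y => ?_)
  rw [preLie_apply]
  refine (finsum_congr fun p => ?_).trans finsum_zero
  have h : app (0 : Conv P O a) (rfl : p.2 + a = p.2 + a) =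
      (0 : P.obj p.1.out.lower p.2 →ₗ[ℚ] _) := rfl
  simp [preLieTerm, h, TensorProduct.map_zero_left]

/-- Writing one as a sum of two weights forces one of them to be zero, and the part of weight zero
vanishes. So `f • f` agrees with the zero product here; `∂_P` also lands in weight zero, and only
the differential of the cocycle remains. -/
theorem curv_of_mem_part_one (f : Conv P O 1) {q : Corolla Ξ} {i : ℤ} {y : P.obj q i}
    (hy : y ∈ G.part 1 q i) (hf : f.1 q i y ∈ O.cocycles q (i + 1)) : (curv f).1 q i y = 0 := by
  have hp : (preLie (show (1 : ℤ) + 1 = 2 by norm_num) f f).1 q i y = 0 := by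
    rw [preLie_congr_on (f' := 0) (g' := 0) _ _ hy, preLie_zero]
    · rfl
    · intro k l hkl r u i j y hy z hz
      obtain rfl | rfl : k = 0 ∨ l = 0 := by omega
      · simp [WeightGrading.eq_zero_of_mem_part_zero hy]
      · simp [WeightGrading.eq_zero_of_mem_part_zero hz]
  rw [curv_apply, hp, WeightGrading.eq_zero_of_mem_part_zero (G.d_mem (k := 0) rfl hy),
    (DGOperad.mem_cocycles _).1 hf]
  simp

/-- On the elements of weight two, the curvatures of two elements which agree in weight one differ
by the differentials of their values. -/
theorem curv_of_mem_part_two {f f' : Conv P O 1}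
    (hf : ∀ (q : Corolla Ξ) (i : ℤ), ∀ y ∈ G.part 1 q i, f.1 q i y = f'.1 q i y)
    {q : Corolla Ξ} {i : ℤ} {y : P.obj q i} (hy : y ∈ G.part 2 q i) :
    (curv f).1 q i y = O.d (show (i + 1) + 1 = i + 2 by omega) (f.1 q i y - f'.1 q i y) +
      (curv f').1 q i y := by
  -- The differential of `y` has weight one, so the terms with `∂_P` coincide.
  rw [curv_apply, curv_apply, app_congr_on hf _ (G.d_mem rfl hy), map_sub,
    preLie_congr_on (f' := f') (g' := f') _ _ hy]
  · abel
  · intro k l hkl r u i j y hy z hz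
    -- Weight zero being trivial, only the splitting of two as one plus one contributes, and there
    -- `f` and `f'` agree.
    obtain rfl | rfl | ⟨rfl, rfl⟩ : k = 0 ∨ l = 0 ∨ k = 1 ∧ l = 1 := by omega
    · simp [WeightGrading.eq_zero_of_mem_part_zero hy]
    · simp [WeightGrading.eq_zero_of_mem_part_zero hz]
    · rw [hf _ _ y hy, hf _ _ z hz]

theorem isMCSprout_two {α : Conv P O 1}
    (h1 : ∀ (q : Corolla Ξ) (i : ℤ), ∀ y ∈ G.part 1 q i, (curv α).1 q i y = 0)
    (h2 : ∀ (q : Corolla Ξ) (i : ℤ), ∀ y ∈ G.part 2 q i, (curv α).1 q i y = 0) :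
    IsMCSprout G 2 α := by
  intro q i j h y hy
  subst h
  have hle : G.filtration 2 q i ≤ LinearMap.ker ((curv α).1 q i) := by
    refine iSup₂_le fun k hk y hy => ?_
    have hk : k ≤ 2 := hk
    interval_cases k
    · rw [WeightGrading.eq_zero_of_mem_part_zero hy]
      exact zero_mem _
    · exact h1 q i y hy
    · exact h2 q i y hy
  exact hle hy

end Conv

/-! ### Construction of the sprout. -/

theorem mainTheorem8 {Ξ : Type x}
    (P : DGPseudoCooperad.{x, v} Ξ) (O : DGOperad.{x, u} Ξ) (H : DGOperad.{x, w} Ξ)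
    (φ : O.cohomology.Hom H) (hφ : φ.IsIso)
    (ρ : (Cobar P).Hom H) (hρ : ρ.IsQuasiIso)
    (G : WeightGrading P) (hG : G.FiniteParts)
    (hO : ∀ (q : Corolla Ξ) (i : ℤ), Module.Finite ℚ (O.obj q i))
    (hgen : ∀ (q : Corolla Ξ) (i : ℤ) (y : H.obj q i),
      H.Generated (fun q j => {z | ∃ (i : ℤ) (h : i + 1 = j), ∃ t ∈ G.part 1 q i,
        Conv.app ρ.toConv h t = z}) q i y)
    (hvan : ∀ k : ℕ, 2 ≤ k → ∀ (q : Corolla Ξ) (i j : ℤ) (h : i + 1 = j), ∀ y ∈ G.part k q i,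
      Conv.app ρ.toConv h y = 0) :
    ∃ α : Conv P O 1, IsMCSprout G 2 α ∧
      ∀ (q : Corolla Ξ) (i j : ℤ) (h : i + 1 = j), ∀ y ∈ G.part 1 q i,
        ∃ hy : Conv.app α h y ∈ O.cocycles q j,
          φ.app (O.toCohomology ⟨Conv.app α h y, hy⟩) = Conv.app ρ.toConv h y := by
  let π : O.cocycleOperad.Hom H := φ.comp (O.cocycleOperad.quotientHom O.coboundaries)
  have hπ : ∀ (q : Corolla Ξ) (i : ℤ) (z : H.obj q i), ∃ y : O.cocycleOperad.obj q i,
      π.app y = z := by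
    intro q i z
    obtain ⟨y, rfl⟩ := (hφ q i).2 z
    obtain ⟨y, rfl⟩ := Submodule.mkQ_surjective _ y
    exact ⟨y, rfl⟩
  -- As `π` is surjective, the pseudo-inverse `s` is a genuine section. It is linear and
  -- equivariant, with no compatibility with composition.
  choose s hsmap hs using fun i : ℤ => DGCollection.exists_equivariant_pseudoinverse
    (A := O.cocycleOperad.toDGCollection) (B := H.toDGCollection) (i := i) (j := i)
    (fun q => π.app) (fun q q' σ y => π.app_map σ y)
  -- On coboundaries `t` chooses primitives: `d t d = d`.
  choose t htmap ht using fun i : ℤ => DGCollection.exists_equivariant_pseudoinverse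
    (A := O.toDGCollection) (B := O.toDGCollection) (i := i + 1) (j := i + 2)
    (fun q => O.d (by omega)) (fun q q' σ y => O.d_map _ σ y)
  -- Values are taken in the operad of cocycles because `π` is a morphism only from there.
  let β' : Conv P O.cocycleOperad 1 :=
    ⟨fun q i => s (i + 1) q ∘ₗ ρ.toConv.1 q i ∘ₗ G.proj 1 q i, fun q q' i σ y => by
      simp only [LinearMap.comp_apply]
      rw [WeightGrading.proj_map, ρ.toConv.2, hsmap]⟩
  have hβ' : Conv.push π β' = ρ.toConv := by
    refine Subtype.ext (funext fun q => funext fun i => LinearMap.ext fun y => ?_)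
    change π.app (s (i + 1) q (ρ.toConv.1 q i (G.proj 1 q i y))) = ρ.toConv.1 q i y
    -- Discarding the weights other than one loses nothing, since `ρ` vanishes on the generators of
    -- weight at least two.
    have hproj : ρ.toConv.1 q i (G.proj 1 q i y) = ρ.toConv.1 q i y := by
      induction y using G.induction_part with
      | zero => simp
      | add y y' hy hy' => simp only [map_add, hy, hy']
      | mem k y hy =>
        by_cases hk : k = 1
        · subst hk
          rw [WeightGrading.proj_of_mem hy]
        · rw [WeightGrading.proj_of_mem_ne hk hy, map_zero]
          obtain rfl | hk : k = 0 ∨ 2 ≤ k := by omega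
          · rw [WeightGrading.eq_zero_of_mem_part_zero hy, map_zero]
          · exact (hvan k hk q i _ rfl y hy).symm
    obtain ⟨z, hz⟩ := hπ q (i + 1) (ρ.toConv.1 q i y)
    rw [hproj, ← hz, hs]
  let β : Conv P O 1 := Conv.push O.cocyclesIncl β'
  have hexact : ∀ (q : Corolla Ξ) (i : ℤ) (y : P.obj q i),
      ∃ z : O.obj q (i + 1), O.d (by omega) z = (Conv.curv β).1 q i y := by
    intro q i y
    -- The projected curvature is the curvature of the Maurer-Cartan element of `ρ`; injectivity of
    -- `φ` then makes the class of `Curv(β')` in the cohomology of `O` vanish.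
    have h0 : π.app ((Conv.curv β').1 q i y) = 0 := by
      change (Conv.push π (Conv.curv β')).1 q i y = 0
      rw [← Conv.curv_push, hβ', ρ.curv_toConv]
      rfl
    have h1 : (O.coboundaries.sub q (i + 2)).mkQ ((Conv.curv β').1 q i y) = 0 :=
      (hφ q (i + 2)).1 (h0.trans (map_zero _).symm)
    obtain ⟨z, hz⟩ := (Submodule.Quotient.mk_eq_zero _).1 h1
    have h2 : (Conv.curv β).1 q i y = ((Conv.curv β').1 q i y).1 := by
      change (Conv.curv (Conv.push O.cocyclesIncl β')).1 q i y = _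
      rw [Conv.curv_push]
      rfl
    rw [h2]
    -- The ideal of coboundaries supplies a primitive in degree `i + 2 - 1`, which must be
    -- transported to degree `i + 1`.
    have hd : ∀ (k : ℤ) (h : k + 1 = i + 2) (z : O.obj q k),
        ∃ z' : O.obj q (i + 1), O.d (by omega) z' = O.d h z := by
      intro k h z
      obtain rfl : k = i + 1 := by omega
      exact ⟨z, rfl⟩
    obtain ⟨z', hz'⟩ := hd _ _ z
    exact ⟨z', hz'.trans hz⟩
  -- The correction is confined to weight two, so the values in weight one stay cocycles lifting
  -- `α_H`.
  let α : Conv P O 1 :=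
    ⟨fun q i => β.1 q i - t i q ∘ₗ (Conv.curv β).1 q i ∘ₗ G.proj 2 q i, fun q q' i σ y => by
      simp only [LinearMap.sub_apply, LinearMap.comp_apply, map_sub]
      rw [WeightGrading.proj_map, β.2, (Conv.curv β).2, htmap]⟩
  have hα : ∀ (q : Corolla Ξ) (i : ℤ) (y : P.obj q i),
      α.1 q i y = β.1 q i y - t i q ((Conv.curv β).1 q i (G.proj 2 q i y)) := fun _ _ _ => rfl
  have hα1 : ∀ (q : Corolla Ξ) (i : ℤ), ∀ y ∈ G.part 1 q i, α.1 q i y = β.1 q i y := by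
    intro q i y hy
    rw [hα, WeightGrading.proj_of_mem_ne (by norm_num) hy]
    simp
  refine ⟨α, Conv.isMCSprout_two (fun q i y hy => ?_) (fun q i y hy => ?_), ?_⟩
  · refine Conv.curv_of_mem_part_one α hy ?_
    rw [hα1 q i y hy]
    exact (β'.1 q i y).2
  -- With `Curv(β)(y) = d z`, the new curvature is `-d t d z + d z`, which is zero.
  · obtain ⟨z, hz⟩ := hexact q i y
    rw [Conv.curv_of_mem_part_two hα1 hy, hα, WeightGrading.proj_of_mem hy, sub_sub_cancel_left,
      map_neg, ← hz, ht, neg_add_cancel]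
  · intro q i j h y hy
    subst h
    have he : Conv.app α rfl y = (β'.1 q i y).1 := hα1 q i y hy
    refine ⟨he ▸ (β'.1 q i y).2, ?_⟩
    have h1 : (⟨Conv.app α rfl y, he ▸ (β'.1 q i y).2⟩ : O.cocycles q (i + 1)) = β'.1 q i y :=
      Subtype.ext he
    rw [h1]
    exact LinearMap.congr_fun (congrFun (congrFun (congrArg Subtype.val hβ') q) i) y
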